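/- Let $\Omega\subset\mathbb R^2$ be bounded and convex, and let $\mathcal N\subset\Omega$ be a network made of finitely many links (simple rectifiable arcs). For two points $s,t$, a route is a simple path from $s$ to $t$ whose trace is a union of links; let $l(s,t)$ be the line segment from $s$ to $t$. A random directional line $G$ has a normal at angle $\theta\in[-\pi,\pi]$ and distance $\rho\ge 0$ from the origin, with the measure $d\rho\,d\theta$, and each of its two directions has weight $1/2$; probabilities are conditional on $G\cap\Omega\ne\emptyset$. The disaster area is the right half-plane $R_G$. Let $0<r<1$. For $\epsilon>0$, divide each link alternately into protected parts of length $r\epsilon$ and unprotected parts of length $(1-r)\epsilon$; $s$ and $t$ are connected if there is a route none of whose links has an unprotected part that meets $R_G$. The weakest arrangement is the limit $\epsilon\to0^+$, and $\Pr(s\leftrightarrow t)$ under it is the limit of the corresponding probabilities. Suppose that there are two different routes $\mathcal O_1,\mathcal O_2$ (the outer routes) such that neither meets any other route except at $s,t$, and the closed area enclosed by $\mathcal O_1\cup\mathcal O_2$ contains all the routes. The inner part $I_i$ of $\mathcal O_i$ is the set of the points of $\mathcal O_i$ that lie in the area enclosed by the other outer route and $l(s,t)$ (that is, about which the closed curve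 formed by these two has a nonzero winding number). Assume that in each of the two open half-planes bounded by the line through $s$ and $t$ at most one of $I_1,I_2$ has points. Suppose that, for $i=1$ or $i=2$, $\mathcal O_i$ consists of $I_i$ and of line segments connecting $I_i$, $s$ and $t$: every point of $\mathcal O_i$ lies in $I_i$ or on a line segment contained in $\mathcal O_i$ with both end points in $\overline{I_i}\cup\{s,t\}$. Then under the weakest arrangement the limit defining $\Pr(s\leftrightarrow t)$ exists and $$\Pr(s\leftrightarrow t)=\frac{\|\Omega\|+\|l(s,t)\|-\sum_{i=1}^2\|\mathrm{conv}(I_i\cup l(s,t))\|}{2\|\Omega\|},$$ where $\|X\|$ denotes the perimeter length of a convex set $X$ (twice the length, for a line segment). It is not assumed that $s$ and $t$ lie on the boundary of $\mathrm{conv}(\mathcal O_1\cup\mathcal O_2)$. -/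

import Mathlib

open Set Filter Topology MeasureTheory
open scoped ENNReal unitInterval

noncomputable section

namespace DisasterNetwork

/-! The Euclidean plane is `ℂ` with its usual norm. -/

/-! ### Perimeter of a convex set -/

/-- The two-dimensional cross product. -/
def cross (a b : ℂ) : ℝ := a.re * b.im - a.im * b.re

/-- `x 0, …, x n` are the vertices, in counterclockwise order, of a strictly convex polygon
(a single point for `n = 0`, any pair of points for `n = 1`, a doubly traversed segment). -/
def IsConvexPolygon {n : ℕ} (x : Fin (n + 1) → ℂ) : Prop :=
  ∀ i j k : Fin (n + 1), i < j → j < k → 0 < cross (x j - x i) (x k - x i)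

/-- Perimeter length of a bounded convex set `X`: the supremum of the lengths of the closed convex
polygons with vertices in `X`. A line segment is traversed twice, so its perimeter is
twice its length. -/
def perimeter (X : Set ℂ) : ℝ :=
  (⨆ (n : ℕ) (x : Fin (n + 1) → ℂ) (_ : ∀ i, x i ∈ X) (_ : IsConvexPolygon x),
    ∑ i, edist (x i) (x (i + 1))).toReal

/-! ### Random directional lines -/

/-- A directional line `G`: its distance `ρ` from the origin, the angle `θ` of its normal, and one
of its two directions. -/
abbrev DirLine : Type := ℝ × ℝ × Bool

/-- Signed position of `z` along the normal of angle `θ`. -/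
def normalCoord (θ : ℝ) (z : ℂ) : ℝ := z.re * Real.cos θ + z.im * Real.sin θ

/-- The points of the line `G`. -/
def DirLine.points (G : DirLine) : Set ℂ := {z | normalCoord G.2.1 z = G.1}

/-- The right half-plane `R_G`; the direction of `G` decides which of the two sides of the line
it is. -/
def DirLine.right (G : DirLine) : Set ℂ :=
  {z | if G.2.2 then G.1 < normalCoord G.2.1 z else normalCoord G.2.1 z < G.1}

/-- The motion-invariant measure `dρ dθ` on lines (`0 ≤ ρ`, `-π ≤ θ ≤ π`), each of the two
directions of a line having weight `1 / 2`. -/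
def lineMeasure : Measure DirLine :=
  (volume.restrict (Ici (0 : ℝ))).prod
    ((volume.restrict (Icc (-Real.pi) Real.pi)).prod ((2⁻¹ : ℝ≥0∞) • Measure.count))

/-- Geometric probability `Pr(X | Y) = m(X ∩ Y) / m(Y)`. -/
def geomProb (X Y : Set DirLine) : ℝ := (lineMeasure (X ∩ Y) / lineMeasure Y).toReal

/-! ### Networks, routes and the weakest arrangement -/

/-- A cable network in the plane: links indexed by `ι`, each one a simple rectifiable curve given by
its parametrization by arc length. -/
structure Network (ι : Type*) where
  /-- length of a link -/
  len : ι → ℝ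
  /-- parametrization of a link -/
  curve : ι → ℝ → ℂ
  len_pos : ∀ e, 0 < len e
  injOn : ∀ e, InjOn (curve e) (Icc 0 (len e))
  unitSpeed : ∀ e, HasUnitSpeedOn (curve e) (Icc 0 (len e))

variable {ι : Type*} {s t : ℂ}

/-- The points of the link `e`. -/
def Network.trace (N : Network ι) (e : ι) : Set ℂ := N.curve e '' Icc 0 (N.len e)

/-- The simple path `γ` from `s` to `t` is a route made up of the links in `S`. -/
def Network.IsRouteVia (N : Network ι) (S : Set ι) (γ : Path s t) : Prop :=
  Function.Injective γ ∧ range γ = ⋃ e ∈ S, N.trace e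

/-- `γ` is a route from `s` to `t` in the network. -/
def Network.IsRoute (N : Network ι) (γ : Path s t) : Prop := ∃ S : Set ι, N.IsRouteVia S γ

/-- The parts of the link `e` that a disaster destroys, when the link is divided alternately into
protected parts of length `r * ε` and unprotected parts of length `(1 - r) * ε`. -/
def Network.weakParts (N : Network ι) (r ε : ℝ) (e : ι) : Set ℂ :=
  N.curve e '' {u ∈ Icc 0 (N.len e) | r ≤ Int.fract (u / ε)}

/-- For the disaster area `D`, some route from `s` to `t` has no destroyed part in `D`. -/
def Network.Connected (N : Network ι) (s t : ℂ) (r ε : ℝ) (D : Set ℂ) : Prop :=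
  ∃ (S : Set ι) (γ : Path s t), N.IsRouteVia S γ ∧ ∀ e ∈ S, Disjoint (N.weakParts r ε e) D

/-- `Pr(s ↔ t)` for the arrangement of mesh `ε`, given that `G` meets `Ω`. -/
def Network.connProb (N : Network ι) (Ω : Set ℂ) (s t : ℂ) (r ε : ℝ) : ℝ :=
  geomProb {G | N.Connected s t r ε G.right} {G | (G.points ∩ Ω).Nonempty}

/-- Under the weakest arrangement (protected share `r`, mesh `ε → 0`), `Pr(s ↔ t)` equals `p`. -/
def Network.WeakestConnProb (N : Network ι) (Ω : Set ℂ) (s t : ℂ) (r p : ℝ) : Prop :=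
  Tendsto (fun ε => N.connProb Ω s t r ε) (𝓝[>] 0) (𝓝 p)

/-! ### Outer routes and inner parts -/

/-- The closed curve `γ` encloses `z`: it avoids `z` and its winding number about `z` is not zero,
that is, a continuous logarithm of `γ - z` does not return to its initial value. -/
def Encloses {a : ℂ} (γ : Path a a) (z : ℂ) : Prop :=
  ∃ L : C(I, ℂ), (∀ u, Complex.exp (L u) = γ u - z) ∧ L 1 ≠ L 0

/-- `O₁` and `O₂` are the two outer routes of the network: they are different, neither of them meets
any other route except at `s` and `t`, and the area that they enclose contains all the routes.
(Two paths with the same points are the same route.) -/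
structure Network.IsOuterPair (N : Network ι) (O₁ O₂ : Path s t) : Prop where
  route₁ : N.IsRoute O₁
  route₂ : N.IsRoute O₂
  range_ne : range O₁ ≠ range O₂
  meet₁ : ∀ γ : Path s t, N.IsRoute γ → range γ ≠ range O₁ → range γ ∩ range O₁ = {s, t}
  meet₂ : ∀ γ : Path s t, N.IsRoute γ → range γ ≠ range O₂ → range γ ∩ range O₂ = {s, t}
  enclosed : ∀ γ : Path s t, N.IsRoute γ →
    range γ ⊆ range O₁ ∪ range O₂ ∪ {z | Encloses (O₁.trans O₂.symm) z}

/-- The union of the inner parts of the outer route `O`, where `O'` is the other outer route: the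
points of `O` in the area enclosed by `O'` and the segment `l(s,t)`. -/
def inner (O O' : Path s t) : Set ℂ :=
  {z ∈ range O | Encloses (O'.trans (Path.segment t s)) z}

/-- `O = I + l(s,t)`: the outer route `O` consists of its inner part `I` and of line segments
connecting `I`, `s` and `t`. -/
def IsInnerPlusSegments (O O' : Path s t) : Prop :=
  ∀ z ∈ range O, z ∈ inner O O' ∨
    ∃ a ∈ closure (inner O O') ∪ {s, t}, ∃ b ∈ closure (inner O O') ∪ {s, t},
      z ∈ segment ℝ a b ∧ segment ℝ a b ⊆ range O

/-- In each of the two half-planes bounded by the line through `s` and `t`, at most one of the two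
outer routes has inner parts. -/
def InnerPartsSeparated (O₁ O₂ : Path s t) : Prop :=
  ∀ x ∈ inner O₁ O₂, ∀ y ∈ inner O₂ O₁, cross (t - s) (x - s) * cross (t - s) (y - s) ≤ 0

end DisasterNetwork

end

noncomputable section

namespace DisasterNetwork

/-! ### Continuous logarithms and winding -/

/-! Fix `G`. Since the disaster area is open, for all small meshes every link that meets `R_G` has
an unprotected part meeting `R_G`. Hence `s` and `t` are connected exactly when some route misses
`R_G` (`Network.eventually_connected_iff`).

Let `O₁` be the decomposed outer route, with inner part `I₁`, and let `K` be the convex hull of `I₁`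
and `l(s,t)`. Some route misses `R_G` if and only if `K` does (`exists_route_iff`). If `K` misses
it, `O₁` itself survives, because its segments stay in the convex complement of `R_G`. Conversely,
let a route `γ` miss `R_G` and let `x` be a point of `I₁` in `R_G`. The cases where `γ` is an outer
route are immediate. Otherwise `γ` can replace `l(s,t)` in the curve that winds around `x`, so `O₁`
runs inside the area of `O₂` and `γ`, while `γ` runs inside the area of `O₁` and `O₂`. Three arcs
with common ends cannot be placed like this (`theta_curve`).

The inner part of `O₂` is empty (`inner_eq_empty`). Separation and the decomposition force it onto
the line through `s` and `t`, off the segment, and a point of it farthest from the midpoint could be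
passed by moving along `O₂`. Its hull with `l(s,t)` is thus `l(s,t)`, whose perimeter cancels,
leaving `(‖Ω‖ - ‖K‖) / (2‖Ω‖)`.

The rest is integral geometry. The perimeter is the integral of the support function
(`perimeter_eq_integral`). The lines meeting `Ω` have measure `‖Ω‖`, and those among them whose
right side misses `K` have measure `(‖Ω‖ - ‖K‖) / 2` (`lineMeasure_avoiding_inter_hitBand`).
Dominated convergence carries the statement for each `G` over to the probabilities. -/

lemma exists_continuous_log {A : Type*} [TopologicalSpace A] [SimplyConnectedSpace A]
    [LocallyPathConnectedSpace A] (f : C(A, ℂ)) (hf : ∀ a, f a ≠ 0) :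
    ∃ L : C(A, ℂ), ∀ a, Complex.exp (L a) = f a := by
  obtain ⟨a₀⟩ : Nonempty A := inferInstance
  obtain ⟨F, ⟨-, hF⟩, -⟩ := Complex.isCoveringMapOn_exp.existsUnique_continuousMap_lifts f
    (Complex.exp_log (hf a₀)) hf
  exact ⟨F, fun a => congrFun hF a⟩

lemma eq_of_exp_eq_const {A : Type*} [TopologicalSpace A] [PreconnectedSpace A] {f : A → ℂ}
    (hf : Continuous f) {w : ℂ} (h : ∀ a, Complex.exp (f a) = w) (a b : A) : f a = f b :=
  Complex.isCoveringMap_exp.const_of_comp hf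
    (fun a b => Subtype.ext ((h a).trans (h b).symm)) a b

/-- Along the path `γ`, a continuous logarithm of `γ - z` changes by `δ`. -/
def LogIncrement {a b : ℂ} (γ : Path a b) (z δ : ℂ) : Prop :=
  ∃ L : C(I, ℂ), (∀ u, Complex.exp (L u) = γ u - z) ∧ L 1 - L 0 = δ

section Winding

variable {a b c : ℂ}

lemma LogIncrement.notMem_range {γ : Path a b} {z δ : ℂ} (h : LogIncrement γ z δ) :
    z ∉ range γ := by
  rintro ⟨u, rfl⟩
  obtain ⟨L, hL, -⟩ := h
  exact Complex.exp_ne_zero _ ((hL u).trans (sub_self _))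

lemma exists_logIncrement {γ : Path a b} {z : ℂ} (hz : z ∉ range γ) :
    ∃ δ, LogIncrement γ z δ := by
  have : ContractibleSpace I := (convex_Icc (0 : ℝ) 1).contractibleSpace ⟨0, by simp⟩
  have : LocallyPathConnectedSpace I := (convex_Icc (0 : ℝ) 1).locallyPathConnectedSpace
  obtain ⟨L, hL⟩ := exists_continuous_log (γ.toContinuousMap - ContinuousMap.const I z)
    (fun u => sub_ne_zero.2 fun h => hz ⟨u, h⟩)
  exact ⟨_, L, hL, rfl⟩

lemma LogIncrement.unique {γ : Path a b} {z δ δ' : ℂ} (h : LogIncrement γ z δ)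
    (h' : LogIncrement γ z δ') : δ = δ' := by
  obtain ⟨L, hL, rfl⟩ := h
  obtain ⟨L', hL', rfl⟩ := h'
  have key : L 1 - L' 1 = L 0 - L' 0 := by
    refine eq_of_exp_eq_const (f := fun u => L u - L' u) (w := 1) (by fun_prop) (fun u => ?_) 1 0
    rw [Complex.exp_sub, hL, hL', div_self]
    rw [← hL]
    exact Complex.exp_ne_zero _
  linear_combination key

lemma LogIncrement.trans {γ : Path a b} {γ' : Path b c} {z δ δ' : ℂ} (h : LogIncrement γ z δ)
    (h' : LogIncrement γ' z δ') : LogIncrement (γ.trans γ') z (δ + δ') := by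
  obtain ⟨L, hL, rfl⟩ := h
  obtain ⟨L', hL', rfl⟩ := h'
  let P : Path (L 0) (L 1) := ⟨L, rfl, rfl⟩
  -- The second logarithm is shifted to start where the first ends; the shift is a period of `exp`.
  let Q : Path (L 1) (L' 1 + (L 1 - L' 0)) :=
    ⟨L' + ContinuousMap.const I (L 1 - L' 0), by simp, by simp⟩
  have hexp : Complex.exp (L 1 - L' 0) = 1 := by
    have h1 := hL 1
    have h0 := hL' 0
    rw [γ.target] at h1
    rw [γ'.source] at h0
    rw [Complex.exp_sub, h1, ← h0, div_self (Complex.exp_ne_zero _)]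
  refine ⟨(P.trans Q).toContinuousMap, fun u => ?_, ?_⟩
  · change Complex.exp ((P.trans Q) u) = _
    rw [Path.trans_apply, Path.trans_apply]
    split_ifs
    · exact hL _
    · change Complex.exp (L' _ + (L 1 - L' 0)) = _
      rw [Complex.exp_add, hexp, mul_one]
      exact hL' _
  · change (P.trans Q) 1 - (P.trans Q) 0 = _
    rw [Path.target, Path.source]
    ring

lemma LogIncrement.symm {γ : Path a b} {z δ : ℂ} (h : LogIncrement γ z δ) :
    LogIncrement γ.symm z (-δ) := by
  obtain ⟨L, hL, rfl⟩ := h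
  refine ⟨L.comp ⟨unitInterval.symm, by fun_prop⟩, fun u => hL _, ?_⟩
  simp

/-- Rotated by `w`, the curve stays in the right half-plane about `z`, where the principal logarithm
is continuous. -/
lemma LogIncrement.of_re_pos {γ : Path a a} {z w : ℂ} (h : ∀ u, 0 < (w * (γ u - z)).re) :
    LogIncrement γ z 0 := by
  have hw : w ≠ 0 := by
    rintro rfl
    simpa using h 0
  refine ⟨⟨fun u => Complex.log (w * (γ u - z)) - Complex.log w, ?_⟩, fun u => ?_, ?_⟩
  · refine (Continuous.clog (by fun_prop) fun u => Or.inl (h u)).sub continuous_const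
  · have hne : w * (γ u - z) ≠ 0 := fun h0 => by simpa [h0] using h u
    change Complex.exp (Complex.log (w * (γ u - z)) - Complex.log w) = _
    rw [Complex.exp_sub, Complex.exp_log hne, Complex.exp_log hw, mul_div_cancel_left₀ _ hw]
  · simp

lemma encloses_iff {γ : Path a a} {z : ℂ} : Encloses γ z ↔ ∃ δ ≠ 0, LogIncrement γ z δ := by
  constructor
  · rintro ⟨L, hL, hne⟩
    exact ⟨_, sub_ne_zero.2 hne, L, hL, rfl⟩
  · rintro ⟨δ, hδ, L, hL, rfl⟩
    exact ⟨L, hL, sub_ne_zero.1 hδ⟩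

lemma Encloses.notMem_range {γ : Path a a} {z : ℂ} (h : Encloses γ z) : z ∉ range γ := by
  obtain ⟨δ, -, h⟩ := encloses_iff.1 h
  exact h.notMem_range

lemma LogIncrement.not_encloses {γ : Path a a} {z : ℂ} (h : LogIncrement γ z 0) :
    ¬ Encloses γ z := by
  intro he
  obtain ⟨δ, hδ, h'⟩ := encloses_iff.1 he
  exact hδ (h'.unique h)

lemma logIncrement_zero_of_not_encloses {γ : Path a a} {z : ℂ} (hz : z ∉ range γ)
    (h : ¬ Encloses γ z) : LogIncrement γ z 0 := by
  obtain ⟨δ, hδ⟩ := exists_logIncrement hz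
  rcases eq_or_ne δ 0 with rfl | h0
  · exact hδ
  · exact absurd (encloses_iff.2 ⟨δ, h0, hδ⟩) h

/-- For `z'` near `z` the quotient `(γ - z') / (γ - z)` stays within distance 1 of 1. Adding its
principal logarithm corrects `L`, and this term returns to its initial value because `γ` is closed.
-/
lemma LogIncrement.eventually {γ : Path a a} {z δ : ℂ} (h : LogIncrement γ z δ) :
    ∀ᶠ z' in 𝓝 z, LogIncrement γ z' δ := by
  have hopen : IsOpen (range γ)ᶜ := (isCompact_range γ.continuous).isClosed.isOpen_compl
  obtain ⟨r, hr, hball⟩ := Metric.isOpen_iff.1 hopen z h.notMem_range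
  obtain ⟨L, hL, rfl⟩ := h
  filter_upwards [Metric.ball_mem_nhds z hr] with z' hz'
  have hne : ∀ u, γ u - z ≠ 0 := fun u => by
    rw [← hL]
    exact Complex.exp_ne_zero _
  have hre : ∀ u, 0 < ((γ u - z') / (γ u - z)).re := fun u => by
    have h1 : ‖(γ u - z) - (γ u - z')‖ < ‖γ u - z‖ := by
      have h2 : r ≤ dist (γ u) z := by
        by_contra hlt
        exact hball (Metric.mem_ball.2 (not_le.1 hlt)) (mem_range_self u)
      rw [← dist_eq_norm (γ u) z]
      refine lt_of_lt_of_le ?_ h2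
      rw [sub_sub_sub_cancel_left, ← dist_eq_norm]
      exact hz'
    have h3 : ‖1 - (γ u - z') / (γ u - z)‖ < 1 := by
      rw [one_sub_div (hne u), norm_div, div_lt_one (norm_pos_iff.2 (hne u))]
      exact h1
    have h4 := (Complex.re_le_norm _).trans_lt h3
    simp only [Complex.sub_re, Complex.one_re] at h4
    linarith
  refine ⟨⟨fun u => L u + Complex.log ((γ u - z') / (γ u - z)), ?_⟩, fun u => ?_, ?_⟩
  · refine L.continuous.add (Continuous.clog (Continuous.div ?_ ?_ hne) fun u => Or.inl (hre u))
    all_goals fun_prop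
  · have hne' : (γ u - z') / (γ u - z) ≠ 0 := fun h0 => by simpa [h0] using hre u
    change Complex.exp (L u + Complex.log _) = _
    rw [Complex.exp_add, Complex.exp_log hne', hL, mul_div_cancel₀ _ (hne u)]
  · simp

lemma isOpen_encloses (γ : Path a a) : IsOpen {z | Encloses γ z} := by
  rw [isOpen_iff_mem_nhds]
  intro z hz
  obtain ⟨δ, hδ, h⟩ := encloses_iff.1 hz
  filter_upwards [h.eventually] with z' hz'
  exact encloses_iff.2 ⟨δ, hδ, hz'⟩

lemma closure_encloses_subset (γ : Path a a) :
    closure {z | Encloses γ z} ⊆ {z | Encloses γ z} ∪ range γ := by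
  intro z hz
  by_contra hcon
  simp only [mem_union, mem_ofPred_eq, not_or] at hcon
  have h0 := (logIncrement_zero_of_not_encloses hcon.2 hcon.1).eventually
  obtain ⟨z', hz', hE⟩ := mem_closure_iff_nhds.1 hz _ h0
  exact LogIncrement.not_encloses hz' hE

/-- From a point outside the disc, the curve lies entirely in a half-plane on the side of the
origin. -/
lemma encloses_subset_closedBall {γ : Path a a} {R : ℝ} (hR : ∀ u, ‖γ u‖ ≤ R) :
    {z | Encloses γ z} ⊆ Metric.closedBall 0 R := by
  intro z hz
  rw [mem_closedBall_zero_iff]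
  by_contra hlt
  refine (LogIncrement.of_re_pos (w := -starRingEnd ℂ z) fun u => ?_).not_encloses hz
  have h1 : (starRingEnd ℂ z * γ u).re ≤ ‖z‖ * R := by
    refine (Complex.re_le_norm _).trans ?_
    rw [norm_mul, RCLike.norm_conj]
    exact mul_le_mul_of_nonneg_left (hR u) (norm_nonneg _)
  have h2 : (starRingEnd ℂ z * z).re = ‖z‖ * ‖z‖ := by
    rw [← Complex.normSq_eq_conj_mul_self, Complex.ofReal_re, Complex.normSq_eq_norm_sq, sq]
  have h3 : (-starRingEnd ℂ z * (γ u - z)).re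
      = (starRingEnd ℂ z * z).re - (starRingEnd ℂ z * γ u).re := by
    rw [neg_mul, mul_sub, Complex.neg_re, Complex.sub_re]
    ring
  have h4 : 0 ≤ R := (norm_nonneg _).trans (hR 0)
  nlinarith [not_le.1 hlt]

/-- The union of two regions cut out by a theta curve does not have its boundary in a single one of
the three arcs. -/
lemma theta_curve {s t : ℂ} {α β γ : Path s t} (hβ : Function.Injective β)
    (hα : range α ⊆ {z | Encloses (β.trans γ.symm) z} ∪ range β)
    (hγ : range γ ⊆ {z | Encloses (α.trans β.symm) z} ∪ range β)
    {x : ℂ} (hx : Encloses (β.trans γ.symm) x) (hxβ : x ∉ range β) : False := by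
  classical
  set P := {z | Encloses (β.trans γ.symm) z} with hP
  set Q := {z | Encloses (α.trans β.symm) z} with hQ
  set F := P ∪ Q ∪ range β with hF
  have hPQ : IsOpen (P ∪ Q) := (isOpen_encloses _).union (isOpen_encloses _)
  have hβc : IsClosed (range β) := (isCompact_range β.continuous).isClosed
  -- The boundary of `P` lies on `β` and `γ`, and `γ` is absorbed by `Q` and `β`; likewise for `Q`,
  -- with `α` absorbed by `P` and `β`. So `F` is closed with frontier in `β`.
  have hFc : IsClosed F := by
    refine isClosed_of_closure_subset ?_
    rw [hF, closure_union, closure_union, hβc.closure_eq]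
    rintro z ((hz | hz) | hz)
    · rcases closure_encloses_subset _ hz with hz | hz
      · exact Or.inl (Or.inl hz)
      · rw [Path.trans_range, Path.symm_range] at hz
        rcases hz with hz | hz
        · exact Or.inr hz
        · rcases hγ hz with hz | hz
          · exact Or.inl (Or.inr hz)
          · exact Or.inr hz
    · rcases closure_encloses_subset _ hz with hz | hz
      · exact Or.inl (Or.inr hz)
      · rw [Path.trans_range, Path.symm_range] at hz
        rcases hz with hz | hz
        · rcases hα hz with hz | hz
          · exact Or.inl (Or.inl hz)
          · exact Or.inr hz
        · exact Or.inr hz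
    · exact Or.inr hz
  have hbdd : Bornology.IsBounded F := by
    have key : ∀ {a b : ℂ} (p : Path a b), ∃ R, ∀ u, ‖p u‖ ≤ R := fun p => by
      obtain ⟨R, hR⟩ := (isCompact_range p.continuous).isBounded.exists_norm_le
      exact ⟨R, fun u => hR _ (mem_range_self u)⟩
    obtain ⟨R₁, h₁⟩ := key (β.trans γ.symm)
    obtain ⟨R₂, h₂⟩ := key (α.trans β.symm)
    exact ((Metric.isBounded_closedBall.subset (encloses_subset_closedBall h₁)).union
      (Metric.isBounded_closedBall.subset (encloses_subset_closedBall h₂))).union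
      (isCompact_range β.continuous).isBounded
  have hxF : x ∈ F := Or.inl (Or.inl hx)
  obtain ⟨-, L, hL, -⟩ := exists_logIncrement hxβ
  have hemb : IsClosedEmbedding β := β.continuous.isClosedEmbedding hβ
  -- The arc `β` carries a logarithm of `z - x`, which extends to the plane by Tietze. Replacing `z
  -- - x` by `exp M` on `F` removes its only zero and keeps continuity across the frontier.
  obtain ⟨M, hM⟩ := ContinuousMap.exists_extension (f := L) hemb
  have hM' : ∀ u, M (β u) = L u := fun u => congrArg (fun f : C(I, ℂ) => f u) hM
  have hcont : Continuous fun z => if z ∈ F then Complex.exp (M z) else z - x := by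
    refine Continuous.if (fun z hz => ?_) (by fun_prop) (by fun_prop)
    change z ∈ frontier F at hz
    rw [hFc.frontier_eq] at hz
    have hzβ : z ∈ range β := by
      rcases hz.1 with h | h
      · exact absurd (interior_maximal subset_union_left hPQ h) hz.2
      · exact h
    obtain ⟨u, rfl⟩ := hzβ
    rw [hM', hL]
  obtain ⟨N, hN⟩ := exists_continuous_log ⟨_, hcont⟩ (fun z => by
    change (if z ∈ F then Complex.exp (M z) else z - x) ≠ 0
    split_ifs with h
    · exact Complex.exp_ne_zero _
    · exact sub_ne_zero.2 fun h' => h (h' ▸ hxF))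
  obtain ⟨R, hR, hFR⟩ := hbdd.subset_ball_lt 0 x
  have hcirc : ∀ u : ℝ, x + R * Complex.exp (u * Complex.I) ∉ F := fun u hu => by
    have := hFR hu
    rw [Metric.mem_ball, dist_eq_norm, add_sub_cancel_left, norm_mul,
      Complex.norm_exp_ofReal_mul_I, mul_one, Complex.norm_real, Real.norm_of_nonneg hR.le] at this
    exact lt_irrefl _ this
  -- On a large circle the modified function is still `z - x`, which winds once, although it now has
  -- a global logarithm.
  have hconst := eq_of_exp_eq_const
    (f := fun u : ℝ => N (x + R * Complex.exp (u * Complex.I)) - u * Complex.I) (w := R)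
    (by fun_prop) (fun u => by
      have h1 : Complex.exp (N (x + R * Complex.exp (u * Complex.I))) = if _ then _ else _ :=
        hN (x + R * Complex.exp (u * Complex.I))
      rw [if_neg (hcirc u), add_sub_cancel_left] at h1
      rw [Complex.exp_sub, h1, mul_div_cancel_right₀ _ (Complex.exp_ne_zero _)]) 0 (2 * Real.pi)
  have h2 : Complex.exp (((2 * Real.pi : ℝ) : ℂ) * Complex.I)
      = Complex.exp (((0 : ℝ) : ℂ) * Complex.I) := by
    push_cast
    rw [Complex.exp_two_pi_mul_I, zero_mul, Complex.exp_zero]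
  simp only [h2] at hconst
  have h3 : ((2 * Real.pi : ℝ) : ℂ) * Complex.I = 0 := by
    push_cast at hconst ⊢
    linear_combination hconst
  simp [Real.pi_ne_zero] at h3

end Winding

/-! ### Outer routes and half-planes -/

lemma convex_halfPlane (w : ℂ) (ρ : ℝ) : Convex ℝ {z : ℂ | (w * z).re ≤ ρ} :=
  convex_halfSpace_le ⟨fun x y => by simp [mul_add], fun r x => by
    simp only [Complex.real_smul, mul_left_comm w, Complex.re_ofReal_mul, smul_eq_mul]⟩ ρ

lemma isClosed_halfPlane (w : ℂ) (ρ : ℝ) : IsClosed {z : ℂ | (w * z).re ≤ ρ} :=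
  isClosed_le (by fun_prop) continuous_const

lemma LogIncrement.of_halfPlane {a : ℂ} {γ : Path a a} {w z : ℂ} {ρ : ℝ}
    (h : ∀ u, (w * γ u).re ≤ ρ) (hz : ρ < (w * z).re) : LogIncrement γ z 0 := by
  refine LogIncrement.of_re_pos (w := -w) fun u => ?_
  have h1 := h u
  have h2 : (-w * (γ u - z)).re = (w * z).re - (w * γ u).re := by
    rw [neg_mul, mul_sub, Complex.neg_re, Complex.sub_re]
    ring
  linarith

section

variable {s t : ℂ}

lemma re_trans_segment_le {O : Path s t} {w : ℂ} {ρ : ℝ} (hO : ∀ u, (w * O u).re ≤ ρ)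
    (u : I) : (w * (O.trans (Path.segment t s)) u).re ≤ ρ := by
  have hs : (w * s).re ≤ ρ := by simpa using hO 0
  have ht : (w * t).re ≤ ρ := by simpa using hO 1
  have hmem : (O.trans (Path.segment t s)) u ∈ range O ∪ segment ℝ t s := by
    rw [← Path.range_segment, ← Path.trans_range]
    exact mem_range_self u
  rcases hmem with ⟨v, hv⟩ | hv
  · rw [← hv]
    exact hO v
  · exact (convex_halfPlane w ρ).segment_subset ht hs hv

lemma not_encloses_trans_segment {O : Path s t} {w z : ℂ} {ρ : ℝ}
    (hO : ∀ u, (w * O u).re ≤ ρ) (hz : ρ < (w * z).re) :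
    ¬ Encloses (O.trans (Path.segment t s)) z :=
  (LogIncrement.of_halfPlane (re_trans_segment_le hO) hz).not_encloses

/-- The decomposition of an outer route enters the proof in this form, with closed half-planes as
`C`. -/
lemma IsInnerPlusSegments.range_subset {O O' : Path s t} (h : IsInnerPlusSegments O O') {C : Set ℂ}
    (hC : IsClosed C) (hC' : Convex ℝ C) (hi : inner O O' ⊆ C) (hs : s ∈ C) (ht : t ∈ C) :
    range O ⊆ C := by
  have key : closure (inner O O') ∪ {s, t} ⊆ C := by
    refine union_subset (closure_minimal hi hC) ?_
    rintro z (rfl | rfl)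
    · exact hs
    · exact ht
  intro z hz
  rcases h z hz with h | ⟨a, ha, b, hb, hab, -⟩
  · exact hi h
  · exact hC'.segment_subset (key ha) (key hb) hab

/-- If `y` were strictly on one side of the line, separation would put the inner part of `O₁`, hence
all of `O₁`, in the opposite closed half-plane, and the loop through `O₁` and the segment could not
wind around `y`. -/
lemma cross_eq_zero_of_mem_inner {O₁ O₂ : Path s t} (hsep : InnerPartsSeparated O₁ O₂)
    (hI : IsInnerPlusSegments O₁ O₂) {y : ℂ} (hy : y ∈ inner O₂ O₁) :
    cross (t - s) (y - s) = 0 := by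
  by_contra hne
  set c := cross (t - s) (y - s) with hc
  -- Chosen so that the real part of `w * (z - s)` is `c` times the cross product, which equals `c ^
  -- 2` at `z = y`.
  set w : ℂ := -Complex.I * starRingEnd ℂ (t - s) * c with hw
  have hcross : ∀ z : ℂ, (w * z).re = (w * s).re + cross (t - s) (z - s) * c := fun z => by
    simp [hw, cross, Complex.mul_re, Complex.mul_im]
    ring
  have hsub := hI.range_subset (isClosed_halfPlane w (w * s).re) (convex_halfPlane w (w * s).re)
    (fun x hx => by
      have h1 := hsep x hx y hy
      rw [mem_ofPred_eq, hcross]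
      linarith) (by simp) (by
      rw [mem_ofPred_eq, hcross]
      simp [cross, mul_comm])
  refine not_encloses_trans_segment (O := O₁) (w := w) (z := y) (ρ := (w * s).re)
    (fun u => hsub (mem_range_self u)) ?_ hy.2
  rw [hcross y, ← hc, lt_add_iff_pos_right]
  exact mul_self_pos.2 hne

/-- The position of the orthogonal projection of `z` on the line through `s` and `t`. -/
def lineCoord (s t z : ℂ) : ℝ := ((z - s) / (t - s)).re

lemma eq_of_cross_eq_zero (hst : s ≠ t) {z : ℂ} (hz : cross (t - s) (z - s) = 0) :
    z = s + lineCoord s t z * (t - s) := by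
  have hne : t - s ≠ 0 := sub_ne_zero.2 hst.symm
  have him : ((z - s) / (t - s)).im = 0 := by
    rw [Complex.div_im, ← sub_div]
    simp only [cross] at hz
    rw [div_eq_zero_iff]
    left
    linarith
  have h : ((lineCoord s t z : ℝ) : ℂ) = (z - s) / (t - s) :=
    Complex.ext rfl (by simp [him])
  rw [h, div_mul_cancel₀ _ hne]
  ring

lemma lineCoord_notMem_Icc (hst : s ≠ t) {z : ℂ} (hz : cross (t - s) (z - s) = 0)
    (hseg : z ∉ segment ℝ s t) : 1 / 2 < |lineCoord s t z - 1 / 2| := by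
  by_contra hle
  rw [not_lt, abs_le] at hle
  refine hseg ?_
  rw [eq_of_cross_eq_zero hst hz, segment_eq_image']
  exact ⟨lineCoord s t z, ⟨by linarith, by linarith⟩, by simp⟩

lemma abs_lineCoord_le_of_mem_segment (hst : s ≠ t) {z : ℂ} (hz : z ∈ segment ℝ s t) :
    |lineCoord s t z - 1 / 2| ≤ 1 / 2 := by
  rw [segment_eq_image'] at hz
  obtain ⟨θ, hθ, rfl⟩ := hz
  have : lineCoord s t (s + θ • (t - s)) = θ := by
    rw [lineCoord, add_sub_cancel_left, Complex.real_smul,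
      mul_div_cancel_right₀ _ (sub_ne_zero.2 hst.symm), Complex.ofReal_re]
  simp only [this]
  rw [abs_le]
  constructor <;> linarith [hθ.1, hθ.2]

/-- If `O₁` is the union of its inner part and of segments, then `O₂` has no inner part. -/
lemma inner_eq_empty {O₁ O₂ : Path s t} (hinj : Function.Injective O₂) (hst : s ≠ t)
    (hmeet : range O₁ ∩ range O₂ = {s, t}) (hsep : InnerPartsSeparated O₁ O₂)
    (hI : IsInnerPlusSegments O₁ O₂) : inner O₂ O₁ = ∅ := by
  by_contra hne
  obtain ⟨y, hy⟩ := nonempty_iff_ne_empty.2 hne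
  set E := inner O₂ O₁ with hE
  have hline : ∀ z ∈ E, cross (t - s) (z - s) = 0 := fun z hz =>
    cross_eq_zero_of_mem_inner hsep hI hz
  have hrange : range (O₁.trans (Path.segment t s)) = range O₁ ∪ segment ℝ s t := by
    rw [Path.trans_range, Path.range_segment, segment_symm]
  have hseg : ∀ z ∈ E, z ∉ segment ℝ s t := fun z hz h =>
    hz.2.notMem_range (hrange ▸ Or.inr h)
  set ψ : I → ℝ := fun u => |lineCoord s t (O₂ u) - 1 / 2| with hψ
  have hκc : Continuous fun u : I => lineCoord s t (O₂ u) := by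
    unfold lineCoord
    fun_prop
  have hψc : Continuous ψ := (hκc.sub continuous_const).abs
  have hcompact : IsCompact {u : I | O₂ u ∈ closure E} :=
    (isClosed_closure.preimage O₂.continuous).isCompact
  obtain ⟨u₀, rfl⟩ := hy.1
  -- The maximum of the distance to the midpoint is taken over the closure of `E`, which makes the
  -- parameter set compact.
  obtain ⟨v, hv, hmax⟩ := hcompact.exists_isMaxOn ⟨u₀, subset_closure hy⟩ hψc.continuousOn
  have hψv : 1 / 2 < ψ v :=
    (lineCoord_notMem_Icc hst (hline _ hy) (hseg _ hy)).trans_le (hmax (subset_closure hy))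
  have hvseg : O₂ v ∉ segment ℝ s t := fun h =>
    absurd (abs_lineCoord_le_of_mem_segment hst h) (not_le.2 hψv)
  have hvs : O₂ v ≠ s := fun h => hvseg (by simpa only [h] using left_mem_segment ℝ s t)
  have hvt : O₂ v ≠ t := fun h => hvseg (by simpa only [h] using right_mem_segment ℝ s t)
  have hvO₁ : O₂ v ∉ range O₁ := fun h => by
    have : O₂ v ∈ ({s, t} : Set ℂ) := hmeet ▸ ⟨h, mem_range_self v⟩
    rcases this with h | h
    · exact hvs h
    · exact hvt h
  -- The boundary of the enclosed region lies on `O₁` and the segment, and the maximizer is on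
  -- neither, so it is an interior point.
  have hvE : Encloses (O₁.trans (Path.segment t s)) (O₂ v) := by
    have h1 : E ⊆ {z | Encloses (O₁.trans (Path.segment t s)) z} := fun z hz => hz.2
    rcases closure_encloses_subset _ (closure_mono h1 hv) with h | h
    · exact h
    · rw [hrange] at h
      exact absurd h (not_or.2 ⟨hvO₁, hvseg⟩)
  have hnhds : {u : I | Encloses (O₁.trans (Path.segment t s)) (O₂ u)} ∈ 𝓝 v :=
    O₂.continuous.continuousAt.preimage_mem_nhds ((isOpen_encloses _).mem_nhds hvE)
  have hv0 : 0 < v := by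
    refine lt_of_le_of_ne v.2.1 fun h => hvs ?_
    exact (congrArg O₂ h.symm).trans O₂.source
  have hv1 : v < 1 := by
    refine lt_of_le_of_ne v.2.2 fun h => hvt ?_
    exact (congrArg O₂ h).trans O₂.target
  obtain ⟨l, m, hlm, hsub⟩ := (mem_nhds_iff_exists_Ioo_subset' ⟨0, hv0⟩ ⟨1, hv1⟩).1 hnhds
  obtain ⟨a, hla, hav⟩ := exists_between hlm.1
  obtain ⟨b, hvb, hbm⟩ := exists_between hlm.2
  have hEab : ∀ u ∈ Icc a b, O₂ u ∈ E := fun u hu =>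
    ⟨mem_range_self u, hsub ⟨hla.trans_le hu.1, hu.2.trans_lt hbm⟩⟩
  have hav' : a ∈ Icc a b := ⟨le_rfl, (hav.trans hvb).le⟩
  have hbv' : b ∈ Icc a b := ⟨(hav.trans hvb).le, le_rfl⟩
  have hvv' : v ∈ Icc a b := ⟨hav.le, hvb.le⟩
  -- Near `v` the path `O₂` runs injectively inside the line, so its coordinate is strictly monotone
  -- there. Beyond the segment, one of the two directions increases the distance to the midpoint.
  have hinjκ : InjOn (fun u : I => lineCoord s t (O₂ u)) (Icc a b) := by
    intro u hu u' hu' h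
    refine hinj ?_
    rw [eq_of_cross_eq_zero hst (hline _ (hEab u hu)),
      eq_of_cross_eq_zero hst (hline _ (hEab u' hu')), show lineCoord s t (O₂ u) = _ from h]
  have hma : |lineCoord s t (O₂ a) - 1 / 2| ≤ |lineCoord s t (O₂ v) - 1 / 2| :=
    hmax (subset_closure (hEab a hav'))
  have hmb : |lineCoord s t (O₂ b) - 1 / 2| ≤ |lineCoord s t (O₂ v) - 1 / 2| :=
    hmax (subset_closure (hEab b hbv'))
  have key : ∀ {p q r : ℝ}, p < q → q < r → |p - 1 / 2| ≤ |q - 1 / 2| →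
      |r - 1 / 2| ≤ |q - 1 / 2| → 1 / 2 < |q - 1 / 2| → False := by
    intro p q r hpq hqr h1 h2 h3
    rcases lt_abs.1 h3 with h | h
    · rw [abs_of_pos (a := q - 1 / 2) (by linarith)] at h2
      linarith [(abs_le.1 h2).2]
    · rw [abs_of_neg (a := q - 1 / 2) (by linarith)] at h1
      linarith [(abs_le.1 h1).1]
  rcases ContinuousOn.strictMonoOn_of_injOn_Icc' (hav.trans hvb).le hκc.continuousOn hinjκ with h | h
  · exact key (h hav' hvv' hav) (h hvv' hbv' hvb) hma hmb hψv
  · exact key (h hvv' hbv' hvb) (h hav' hvv' hav) hmb hma hψv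

/-! ### Arbitrary routes compared with the outer pair -/

variable {ι : Type*} {N : Network ι}

lemma Network.IsOuterPair.swap {O₁ O₂ : Path s t} (h : N.IsOuterPair O₁ O₂) :
    N.IsOuterPair O₂ O₁ where
  route₁ := h.route₂
  route₂ := h.route₁
  range_ne := h.range_ne.symm
  meet₁ := h.meet₂
  meet₂ := h.meet₁
  enclosed γ hγ := by
    intro z hz
    rcases h.enclosed γ hγ hz with (h | h) | h
    · exact Or.inl (Or.inr h)
    · exact Or.inl (Or.inl h)
    · right
      have hz := h.notMem_range
      rw [Path.trans_range, Path.symm_range, mem_union, not_or] at hz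
      obtain ⟨δ₁, h₁⟩ := exists_logIncrement hz.1
      obtain ⟨δ₂, h₂⟩ := exists_logIncrement hz.2
      obtain ⟨δ, hδ, h'⟩ := encloses_iff.1 h
      refine encloses_iff.2 ⟨δ₂ + -δ₁, fun h0 => hδ ?_, h₂.trans h₁.symm⟩
      rw [h'.unique (h₁.trans h₂.symm)]
      linear_combination -h0

/-- A half-plane that is missed by some route contains no inner point of an outer route. -/
lemma re_le_of_mem_inner {O₁ O₂ γ : Path s t} (hO : N.IsOuterPair O₁ O₂) (hγ : N.IsRoute γ)
    {w : ℂ} {ρ : ℝ} (hρ : ∀ u, (w * γ u).re ≤ ρ) {x : ℂ} (hx : x ∈ inner O₁ O₂) :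
    (w * x).re ≤ ρ := by
  by_contra hlt
  rw [not_le] at hlt
  have hxγ : x ∉ range γ := by
    rintro ⟨u, rfl⟩
    exact absurd (hρ u) (not_le.2 hlt)
  by_cases h1 : range γ = range O₁
  · exact hxγ (h1 ▸ hx.1)
  by_cases h2 : range γ = range O₂
  · refine not_encloses_trans_segment (O := O₂) (fun u => ?_) hlt hx.2
    obtain ⟨v, hv⟩ : O₂ u ∈ range γ := h2 ▸ mem_range_self u
    rw [← hv]
    exact hρ v
  have hinj₂ : Function.Injective O₂ := hO.route₂.choose_spec.1
  have hinj₁ : Function.Injective O₁ := hO.route₁.choose_spec.1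
  have hxr := hx.2.notMem_range
  rw [Path.trans_range, mem_union, not_or] at hxr
  have hs₂ : s ∈ range O₂ := ⟨0, O₂.source⟩
  have ht₂ : t ∈ range O₂ := ⟨1, O₂.target⟩
  have hst₂ : ({s, t} : Set ℂ) ⊆ range O₂ := by
    rintro z (rfl | rfl)
    · exact hs₂
    · exact ht₂
  -- `γ` and the segment form a loop in a half-plane avoiding `x`, with increment 0, so `γ` may
  -- replace the segment.
  have hxE : Encloses (O₂.trans γ.symm) x := by
    obtain ⟨δ₂, h₂⟩ := exists_logIncrement hxr.1
    obtain ⟨δl, hl⟩ := exists_logIncrement hxr.2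
    obtain ⟨δγ, hγ'⟩ := exists_logIncrement hxγ
    obtain ⟨δ, hδ, h'⟩ := encloses_iff.1 hx.2
    have e1 := h'.unique (h₂.trans hl)
    have e2 := (hγ'.trans hl).unique (LogIncrement.of_halfPlane (re_trans_segment_le hρ) hlt)
    refine encloses_iff.2 ⟨δ₂ + -δγ, fun h0 => hδ ?_, h₂.trans hγ'.symm⟩
    linear_combination e1 + h0 + e2
  refine theta_curve (α := O₁) (β := O₂) (γ := γ) hinj₂ ?_ ?_ hxE hxr.1
  -- The open arc of `O₁` is connected, passes through `x` and meets neither `O₂` nor `γ`, so it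
  -- never leaves the enclosed region.
  · have hpre : IsPreconnected (O₁ '' Ioo 0 1) :=
      isPreconnected_Ioo.image _ O₁.continuous.continuousOn
    have hsub : O₁ '' Ioo 0 1 ⊆ {z | Encloses (O₂.trans γ.symm) z} := by
      refine hpre.subset_of_closure_inter_subset (isOpen_encloses _) ⟨x, ?_, hxE⟩ ?_
      · obtain ⟨u, hu⟩ := hx.1
        refine ⟨u, ⟨lt_of_le_of_ne u.2.1 fun h => hxr.1 ?_, lt_of_le_of_ne u.2.2 fun h => hxr.1 ?_⟩,
          hu⟩
        · rw [← hu, show u = 0 from h.symm, O₁.source]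
          exact hs₂
        · rw [← hu, show u = 1 from h, O₁.target]
          exact ht₂
      · rintro z ⟨hz, u, hu, rfl⟩
        rcases closure_encloses_subset _ hz with h | h
        · exact h
        rw [Path.trans_range, Path.symm_range] at h
        have hmem : O₁ u ∈ ({s, t} : Set ℂ) := by
          rcases h with h | h
          · rw [← hO.meet₁ O₂ hO.route₂ hO.range_ne.symm]
            exact ⟨h, mem_range_self u⟩
          · rw [← hO.meet₁ γ hγ h1]
            exact ⟨h, mem_range_self u⟩
        rcases hmem with h | h
        · exact absurd (hinj₁ (h.trans O₁.source.symm)) hu.1.ne'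
        · exact absurd (hinj₁ (h.trans O₁.target.symm)) hu.2.ne
    rintro z ⟨u, rfl⟩
    rcases u.2.1.eq_or_lt with h | h0
    · right
      rw [show u = 0 from Subtype.ext h.symm, O₁.source]
      exact hs₂
    rcases u.2.2.eq_or_lt with h | h1
    · right
      rw [show u = 1 from Subtype.ext h, O₁.target]
      exact ht₂
    · exact Or.inl (hsub ⟨u, ⟨h0, h1⟩, rfl⟩)
  · intro z hz
    rcases hO.enclosed γ hγ hz with (h | h) | h
    · exact Or.inr (hst₂ (hO.meet₁ γ hγ h1 ▸ ⟨hz, h⟩))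
    · exact Or.inr h
    · exact Or.inl h

/-- Some route misses an open half-plane if and only if the segment `l(s,t)` and the inner part of
`O₁` do, provided that `O₁` is the union of its inner part and of segments. -/
lemma exists_route_iff {O₁ O₂ : Path s t} (hO : N.IsOuterPair O₁ O₂)
    (hI : IsInnerPlusSegments O₁ O₂) (w : ℂ) (ρ : ℝ) :
    (∃ γ : Path s t, N.IsRoute γ ∧ ∀ u, (w * γ u).re ≤ ρ) ↔
      ∀ z ∈ inner O₁ O₂ ∪ segment ℝ s t, (w * z).re ≤ ρ := by
  constructor
  · rintro ⟨γ, hγ, hρ⟩ z (hz | hz)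
    · exact re_le_of_mem_inner hO hγ hρ hz
    · exact (convex_halfPlane w ρ).segment_subset (by simpa using hρ 0) (by simpa using hρ 1) hz
  · intro h
    refine ⟨O₁, hO.route₁, fun u => ?_⟩
    exact hI.range_subset (isClosed_halfPlane w ρ) (convex_halfPlane w ρ)
      (fun z hz => h z (Or.inl hz)) (h s (Or.inr (left_mem_segment ℝ s t)))
      (h t (Or.inr (right_mem_segment ℝ s t))) (mem_range_self u)

end

/-! ### Convex polygons -/

/-- This is the affine dependence of four points, weighted by signed areas. In a convex
quadrilateral it expresses that the diagonals `ac` and `bd` cross. -/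
lemma cross_quad (a b c d : ℂ) :
    cross (c - b) (d - b) • a + cross (b - a) (d - a) • c
      = cross (c - a) (d - a) • b + cross (b - a) (c - a) • d := by
  apply Complex.ext <;> simp [cross] <;> ring

/-- In a convex quadrilateral `a, b, c, d`, if `f` is larger at `d` than at both neighbours of `d`,
then it is at most the maximum over these neighbours at `b`. -/
lemma le_of_cross_pos {a b c d : ℂ} (f : ℂ →ₗ[ℝ] ℝ) {M : ℝ} (h₁ : 0 < cross (c - b) (d - b))
    (h₂ : 0 < cross (b - a) (d - a)) (h₃ : 0 < cross (c - a) (d - a))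
    (h₄ : 0 < cross (b - a) (c - a)) (ha : f a ≤ M) (hc : f c ≤ M) (hd : M ≤ f d) : f b ≤ M := by
  have key := congrArg f (cross_quad a b c d)
  simp only [map_add, map_smul, smul_eq_mul] at key
  have hsum : cross (c - b) (d - b) + cross (b - a) (d - a)
      = cross (c - a) (d - a) + cross (b - a) (c - a) := by
    simp [cross]
    ring
  by_contra hlt
  rw [not_le] at hlt
  have hM := congrArg (· * M) hsum
  simp only [add_mul] at hM
  linarith [mul_le_mul_of_nonneg_left ha h₁.le, mul_le_mul_of_nonneg_left hc h₂.le,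
    mul_le_mul_of_nonneg_left hd h₄.le, mul_lt_mul_of_pos_left hlt h₃]

/-- The vertices `0, j, m, m + 1` form a convex quadrilateral in which `0` and `m` are the
neighbours of `m + 1`. -/
lemma le_max_of_convex_chain {x : ℕ → ℂ} {m : ℕ}
    (hx : ∀ i j k, i < j → j < k → k ≤ m + 1 → 0 < cross (x j - x i) (x k - x i))
    (f : ℂ →ₗ[ℝ] ℝ) (h0 : f (x 0) ≤ f (x (m + 1))) (hm : f (x m) ≤ f (x (m + 1)))
    {j : ℕ} (hj : j ≤ m) : f (x j) ≤ max (f (x 0)) (f (x m)) := by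
  rcases Nat.eq_zero_or_pos j with rfl | hj0
  · exact le_max_left _ _
  rcases hj.eq_or_lt with rfl | hjm
  · exact le_max_right _ _
  exact le_of_cross_pos f (hx j m (m + 1) hjm (by omega) le_rfl)
    (hx 0 j (m + 1) hj0 (by omega) le_rfl) (hx 0 m (m + 1) (by omega) (by omega) le_rfl)
    (hx 0 j m hj0 hjm (by omega)) (le_max_left _ _) (le_max_right _ _) (max_le h0 hm)

/-- A linear functional on the vertices of a convex polygon rises once and falls once. -/
lemma exists_sum_abs_sub_eq {x : ℕ → ℂ} (f : ℂ →ₗ[ℝ] ℝ) (n : ℕ)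
    (hx : ∀ i j k, i < j → j < k → k ≤ n → 0 < cross (x j - x i) (x k - x i)) :
    ∃ p ≤ n, ∃ q ≤ n, (∀ i ≤ n, f (x i) ≤ f (x p)) ∧ (∀ i ≤ n, f (x q) ≤ f (x i)) ∧
      ∑ i ∈ Finset.range n, |f (x (i + 1)) - f (x i)| + |f (x 0) - f (x n)|
        = 2 * (f (x p) - f (x q)) := by
  induction n with
  | zero =>
    refine ⟨0, le_rfl, 0, le_rfl, ?_, ?_, by simp⟩ <;>
    · intro i hi
      rw [Nat.le_zero.1 hi]
  | succ m ih =>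
    obtain ⟨p, hp, q, hq, hmax, hmin, hsum⟩ :=
      ih fun i j k hij hjk hk => hx i j k hij hjk (by omega)
    have ext_max : ∀ {y : ℝ}, (∀ i ≤ m, f (x i) ≤ y) → f (x (m + 1)) ≤ y →
        ∀ i ≤ m + 1, f (x i) ≤ y := fun h h' i hi => by
      rcases hi.eq_or_lt with rfl | hi
      · exact h'
      · exact h i (by omega)
    have ext_min : ∀ {y : ℝ}, (∀ i ≤ m, y ≤ f (x i)) → y ≤ f (x (m + 1)) →
        ∀ i ≤ m + 1, y ≤ f (x i) := fun h h' i hi => by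
      rcases hi.eq_or_lt with rfl | hi
      · exact h'
      · exact h i (by omega)
    rw [Finset.sum_range_succ]
    have h0p := hmax 0 (by omega)
    have hmp := hmax m le_rfl
    have h0q := hmin 0 (by omega)
    have hmq := hmin m le_rfl
    rcases le_total (f (x 0)) (f (x (m + 1))) with h0 | h0 <;>
    rcases le_total (f (x m)) (f (x (m + 1))) with hm | hm
    -- The new vertex is a peak: the old maximum was at one of its neighbours, and the total
    -- variation grows by twice the rise.
    · have hP : f (x p) = max (f (x 0)) (f (x m)) :=
        le_antisymm (le_max_of_convex_chain hx f h0 hm hp) (max_le h0p hmp)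
      have hPle : f (x p) ≤ f (x (m + 1)) := hP ▸ max_le h0 hm
      refine ⟨m + 1, le_rfl, q, by omega, ext_max (fun i hi => (hmax i hi).trans hPle) le_rfl,
        ext_min hmin (hmq.trans hm), ?_⟩
      rw [abs_of_nonneg (a := f (x (m + 1)) - f (x m)) (by linarith),
        abs_of_nonpos (a := f (x 0) - f (x (m + 1))) (by linarith)]
      rcases le_total (f (x 0)) (f (x m)) with h | h
      · rw [max_eq_right h] at hP
        rw [abs_of_nonpos (by linarith)] at hsum
        linarith
      · rw [max_eq_left h] at hP
        rw [abs_of_nonneg (by linarith)] at hsum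
        linarith
    -- The new value lies between those of its neighbours, so splitting the closing edge does not
    -- change the variation.
    · refine ⟨p, by omega, q, by omega, ext_max hmax (by linarith), ext_min hmin (by linarith), ?_⟩
      rw [abs_of_nonpos (a := f (x (m + 1)) - f (x m)) (by linarith),
        abs_of_nonpos (a := f (x 0) - f (x (m + 1))) (by linarith)]
      rw [abs_of_nonpos (by linarith)] at hsum
      linarith
    · refine ⟨p, by omega, q, by omega, ext_max hmax (by linarith), ext_min hmin (by linarith), ?_⟩
      rw [abs_of_nonneg (a := f (x (m + 1)) - f (x m)) (by linarith),
        abs_of_nonneg (a := f (x 0) - f (x (m + 1))) (by linarith)]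
      rw [abs_of_nonneg (by linarith)] at hsum
      linarith
    -- The new vertex is a trough: this is the peak case for `-f`.
    · have hchain : ∀ j ≤ m, min (f (x 0)) (f (x m)) ≤ f (x j) := fun j hj => by
        have := le_max_of_convex_chain hx (-f) (by simpa using h0) (by simpa using hm) hj
        simp only [LinearMap.neg_apply, max_neg_neg] at this
        linarith
      have hQ : f (x q) = min (f (x 0)) (f (x m)) :=
        le_antisymm (le_min h0q hmq) (hchain q hq)
      have hQle : f (x (m + 1)) ≤ f (x q) := hQ ▸ le_min h0 hm
      refine ⟨p, by omega, m + 1, le_rfl, ext_max hmax (hm.trans hmp),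
        ext_min (fun i hi => hQle.trans (hmin i hi)) le_rfl, ?_⟩
      rw [abs_of_nonpos (a := f (x (m + 1)) - f (x m)) (by linarith),
        abs_of_nonneg (a := f (x 0) - f (x (m + 1))) (by linarith)]
      rcases le_total (f (x 0)) (f (x m)) with h | h
      · rw [min_eq_left h] at hQ
        rw [abs_of_nonpos (by linarith)] at hsum
        linarith
      · rw [min_eq_right h] at hQ
        rw [abs_of_nonneg (by linarith)] at hsum
        linarith

lemma IsConvexPolygon.exists_sum_abs_sub_eq {n : ℕ} {x : Fin (n + 1) → ℂ} (hx : IsConvexPolygon x)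
    (f : ℂ →ₗ[ℝ] ℝ) :
    ∃ p q, (∀ i, f (x i) ≤ f (x p)) ∧ (∀ i, f (x q) ≤ f (x i)) ∧
      ∑ i, |f (x (i + 1)) - f (x i)| = 2 * (f (x p) - f (x q)) := by
  set y : ℕ → ℂ := fun i => if h : i < n + 1 then x ⟨i, h⟩ else 0 with hy
  have hyx : ∀ i (h : i < n + 1), y i = x ⟨i, h⟩ := fun i h => dif_pos h
  obtain ⟨p, hp, q, hq, hmax, hmin, hsum⟩ :=
    DisasterNetwork.exists_sum_abs_sub_eq (x := y) f n fun i j k hij hjk hk => by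
      rw [hyx i (by omega), hyx j (by omega), hyx k (by omega)]
      exact hx _ _ _ hij hjk
  rw [hyx p (by omega), hyx q (by omega)] at hsum
  refine ⟨⟨p, by omega⟩, ⟨q, by omega⟩, fun i => ?_, fun i => ?_, ?_⟩
  · have := hmax i (by omega)
    rwa [hyx p (by omega), hyx i i.2] at this
  · have := hmin i (by omega)
    rwa [hyx q (by omega), hyx i i.2] at this
  · rw [← hsum, Fin.sum_univ_castSucc, Fin.last_add_one, Finset.sum_range]
    congr 1
    · refine Finset.sum_congr rfl fun i _ => ?_
      rw [Fin.coeSucc_eq_succ, hyx (i + 1) (by omega), hyx i (by omega)]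
      rfl
    · rw [hyx 0 (by omega), hyx n (by omega)]
      rfl

/-! ### Finite sets, convex position and angular order -/

lemma cross_eq_norm_mul_sin (a b : ℂ) :
    cross a b = ‖a‖ * ‖b‖ * Real.sin (b.arg - a.arg) := by
  rw [Real.sin_sub, cross]
  linear_combination -(‖b‖ * Real.sin b.arg) * Complex.norm_mul_cos_arg a
    - a.re * Complex.norm_mul_sin_arg b + ‖b‖ * Real.cos b.arg * Complex.norm_mul_sin_arg a
    + a.im * Complex.norm_mul_cos_arg b

/-- If `b` lies in the angle `a, 0, c` but not beyond the chord from `a` to `c`, then it is in the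
triangle `0, a, c`. -/
lemma mem_convexHull_of_cross_nonpos {a b c : ℂ} (hab : 0 < cross a b) (hbc : 0 < cross b c)
    (hac : 0 < cross a c) (h : cross (b - a) (c - a) ≤ 0) {S : Set ℂ} {p : ℂ} (hp : p ∈ S)
    (ha : p + a ∈ S) (hc : p + c ∈ S) : p + b ∈ convexHull ℝ S := by
  have hS : S ⊆ convexHull ℝ S := subset_convexHull ℝ S
  have hle : cross b c + cross a b ≤ cross a c := by
    have : cross (b - a) (c - a) = cross b c + cross a b - cross a c := by
      simp [cross]
      ring
    linarith
  have hb : p + b = ((cross a c - cross b c - cross a b) / cross a c) • p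
      + (cross b c / cross a c) • (p + a) + (cross a b / cross a c) • (p + c) := by
    have hne : ((cross a c : ℝ) : ℂ) ≠ 0 := by exact_mod_cast hac.ne'
    have hq : ((cross b c : ℝ) : ℂ) * a + (cross a b : ℝ) * c = (cross a c : ℝ) * b := by
      apply Complex.ext <;> simp [cross] <;> ring
    simp only [Complex.real_smul, Complex.ofReal_div, Complex.ofReal_sub]
    field_simp
    linear_combination -hq
  rw [hb]
  have key := (convex_convexHull ℝ S).sum_mem (t := Finset.univ)
    (w := ![(cross a c - cross b c - cross a b) / cross a c, cross b c / cross a c,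
      cross a b / cross a c]) (z := ![p, p + a, p + c]) ?_ ?_ ?_
  · rw [Fin.sum_univ_three] at key
    exact key
  · intro i _
    fin_cases i
    · exact div_nonneg (by linarith) hac.le
    · exact div_nonneg hbc.le hac.le
    · exact div_nonneg hab.le hac.le
  · simp only [Fin.sum_univ_three, Matrix.cons_val_zero, Matrix.cons_val_one, Matrix.cons_val]
    field_simp
    ring
  · intro i _
    fin_cases i
    · exact hS hp
    · exact hS ha
    · exact hS hc

/-- A finite set of points is contained in the convex hull of a subset in convex position. -/
lemma exists_convexPosition_subset (F : Finset ℂ) :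
    ∃ F' ⊆ F, (F : Set ℂ) ⊆ convexHull ℝ (F' : Set ℂ) ∧
      ∀ x ∈ F', x ∉ convexHull ℝ (F' \ {x} : Set ℂ) := by
  classical
  have hne : (F.powerset.filter fun F' : Finset ℂ => (F : Set ℂ) ⊆ convexHull ℝ (F' : Set ℂ)).Nonempty :=
    ⟨F, by simp [subset_convexHull ℝ (F : Set ℂ)]⟩
  -- A subset of least cardinality that still spans `F` has no redundant point.
  obtain ⟨F', hF', hmin⟩ := Finset.exists_min_image _ Finset.card hne
  simp only [Finset.mem_filter, Finset.mem_powerset] at hF' hmin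
  refine ⟨F', hF'.1, hF'.2, fun x hx hxc => ?_⟩
  have hsub : (F' : Set ℂ) ⊆ convexHull ℝ (F' \ {x} : Set ℂ) := fun z hz => by
    rcases eq_or_ne z x with rfl | h
    · exact hxc
    · exact subset_convexHull ℝ _ ⟨hz, h⟩
  have hlt := hmin (F'.erase x) ⟨(F'.erase_subset x).trans hF'.1, by
    rw [Finset.coe_erase]
    exact hF'.2.trans (convexHull_min hsub (convex_convexHull ℝ _))⟩
  exact absurd hlt (not_le.2 (Finset.card_erase_lt_of_mem hx))

/-- The half-open half-plane is where all other points lie as seen from a lexicographically least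
one; arguments there fill `(-π/2, π/2]`. -/
lemma arg_sub_arg_lt_pi {a b : ℂ} (ha : 0 < a.re ∨ a.re = 0 ∧ 0 < a.im)
    (hb : 0 < b.re ∨ b.re = 0 ∧ 0 < b.im) : b.arg - a.arg < Real.pi := by
  have key : ∀ z : ℂ, (0 < z.re ∨ z.re = 0 ∧ 0 < z.im) →
      -(Real.pi / 2) < z.arg ∧ z.arg ≤ Real.pi / 2 := fun z hz => by
    have hre : 0 ≤ z.re := by
      rcases hz with h | h
      · exact h.le
      · exact h.1.ge
    have habs := abs_le.1 (Complex.abs_arg_le_pi_div_two_iff.2 hre)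
    refine ⟨lt_of_le_of_ne habs.1 fun h => ?_, habs.2⟩
    have h' := Complex.arg_eq_neg_pi_div_two_iff.1 h.symm
    rcases hz with hz | hz
    · exact hz.ne' h'.1
    · exact lt_asymm hz.2 h'.2
  linarith [(key a ha).1, (key b hb).2]

/-- A finite set of points is contained in the convex hull of a convex polygon whose vertices belong
to the set. -/
lemma exists_isConvexPolygon (F : Finset ℂ) (hF : F.Nonempty) :
    ∃ (n : ℕ) (x : Fin (n + 1) → ℂ), (∀ i, x i ∈ F) ∧ IsConvexPolygon x ∧
      (F : Set ℂ) ⊆ convexHull ℝ (range x) := by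
  classical
  obtain ⟨F', hF'F, hcov, hpos⟩ := exists_convexPosition_subset F
  have hF' : F'.Nonempty := by
    rw [Finset.nonempty_iff_ne_empty]
    rintro rfl
    obtain ⟨z, hz⟩ := hF
    simpa using hcov hz
  -- The lexicographically least point is the first vertex; the others are sorted by their angle as
  -- seen from it.
  obtain ⟨p, hp, hmin⟩ := Finset.exists_min_image F' (fun z => toLex (z.re, z.im)) hF'
  have hhalf : ∀ z ∈ F'.erase p, 0 < (z - p).re ∨ (z - p).re = 0 ∧ 0 < (z - p).im := by
    intro z hz
    rw [Finset.mem_erase] at hz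
    have h := hmin z hz.2
    rw [Prod.Lex.toLex_le_toLex] at h
    simp only [Complex.sub_re, Complex.sub_im, sub_pos, sub_eq_zero]
    rcases h with h | ⟨h, h'⟩
    · exact Or.inl h
    · exact Or.inr ⟨h.symm, lt_of_le_of_ne h' fun h'' => hz.1 (Complex.ext h h'').symm⟩
  have hne0 : ∀ z ∈ F'.erase p, z - p ≠ 0 := fun z hz =>
    sub_ne_zero.2 (Finset.ne_of_mem_erase hz)
  have hcross : ∀ y ∈ F'.erase p, ∀ z ∈ F'.erase p, (y - p).arg < (z - p).arg →
      0 < cross (y - p) (z - p) := fun y hy z hz h => by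
    rw [cross_eq_norm_mul_sin]
    exact mul_pos (mul_pos (norm_pos_iff.2 (hne0 y hy)) (norm_pos_iff.2 (hne0 z hz)))
      (Real.sin_pos_of_pos_of_lt_pi (sub_pos.2 h) (arg_sub_arg_lt_pi (hhalf y hy) (hhalf z hz)))
  have hchord : ∀ y ∈ F'.erase p, ∀ z ∈ F'.erase p, y ≠ z → ∀ c : ℝ, 0 < c → c ≤ 1 →
      z - p ≠ c * (y - p) := fun y hy z hz hyz c hc hc1 h => by
    refine hpos z (Finset.mem_of_mem_erase hz) ?_
    refine segment_subset_convexHull (x := p) (y := y)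
      (s := (F' : Set ℂ) \ {z}) ⟨hp, (Finset.ne_of_mem_erase hz).symm⟩ ⟨Finset.mem_of_mem_erase hy, hyz⟩ ?_
    rw [segment_eq_image']
    refine ⟨c, ⟨hc.le, hc1⟩, ?_⟩
    simp only [Complex.real_smul]
    linear_combination -h
  -- Of two points in the same direction from `p`, the nearer would lie on the segment from `p` to
  -- the farther, against convex position.
  have hinj : InjOn (fun z => (z - p).arg) (F'.erase p : Set ℂ) := by
    intro y hy z hz h
    by_contra hyz
    obtain ⟨c, hc, hcz⟩ : ∃ c : ℝ, 0 < c ∧ z - p = c * (y - p) := by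
      refine ⟨‖z - p‖ / ‖y - p‖,
        div_pos (norm_pos_iff.2 (hne0 z hz)) (norm_pos_iff.2 (hne0 y hy)), ?_⟩
      have := (Complex.arg_eq_arg_iff (hne0 y hy) (hne0 z hz)).1 h
      push_cast
      exact this.symm
    rcases le_total c 1 with h1 | h1
    · exact hchord y hy z hz hyz c hc h1 hcz
    · refine hchord z hz y hy (Ne.symm hyz) c⁻¹ (inv_pos.2 hc) (inv_le_one_of_one_le₀ h1) ?_
      rw [hcz, Complex.ofReal_inv, inv_mul_cancel_left₀]
      exact_mod_cast hc.ne'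
  set A := (F'.erase p).image fun z => (z - p).arg with hA
  set e := A.orderEmbOfFin rfl with he
  have hpre : ∀ i, ∃ z ∈ F'.erase p, (z - p).arg = e i := fun i =>
    Finset.mem_image.1 (Finset.orderEmbOfFin_mem A rfl i)
  choose x hxmem hxarg using hpre
  have hxmono : ∀ i j, i < j → (x i - p).arg < (x j - p).arg := fun i j hij => by
    rw [hxarg, hxarg]
    exact e.strictMono hij
  refine ⟨A.card, Fin.cons p x, fun i => ?_, ?_, ?_⟩
  · refine Fin.cases ?_ (fun i => ?_) i
    · exact hF'F hp
    · exact hF'F (Finset.mem_of_mem_erase (hxmem i))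
  · intro i j k hij hjk
    obtain ⟨j, rfl⟩ := Fin.exists_succ_eq.2 (Fin.ne_zero_of_lt hij)
    obtain ⟨k, rfl⟩ := Fin.exists_succ_eq.2 (Fin.ne_zero_of_lt hjk)
    rw [Fin.succ_lt_succ_iff] at hjk
    have hjk' := hcross _ (hxmem j) _ (hxmem k) (hxmono j k hjk)
    refine Fin.cases (fun _ => ?_) (fun i hij => ?_) i hij
    · simpa using hjk'
    · rw [Fin.succ_lt_succ_iff] at hij
      simp only [Fin.cons_succ]
      -- Without a left turn, `x j` would lie in the triangle `p, x i, x k`, again against convex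
      -- position.
      by_contra hle
      have hij' := hcross _ (hxmem i) _ (hxmem j) (hxmono i j hij)
      have hik' := hcross _ (hxmem i) _ (hxmem k) (hxmono i k (hij.trans hjk))
      have hne : ∀ {i j}, i < j → x i ≠ x j := fun h h' => (hxmono _ _ h).ne (by rw [h'])
      refine hpos _ (Finset.mem_of_mem_erase (hxmem j)) ?_
      have := mem_convexHull_of_cross_nonpos hij' hjk' hik' (p := p)
        (S := (F' : Set ℂ) \ {x j}) (by simpa using hle)
        ⟨hp, (Finset.ne_of_mem_erase (hxmem j)).symm⟩
        (by simpa using ⟨Finset.mem_of_mem_erase (hxmem i), hne hij⟩)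
        (by simpa using ⟨Finset.mem_of_mem_erase (hxmem k), (hne hjk).symm⟩)
      simpa using this
  · refine hcov.trans (convexHull_mono fun z hz => ?_)
    rcases eq_or_ne z p with rfl | hzp
    · exact ⟨0, rfl⟩
    · have hz' : z ∈ F'.erase p := Finset.mem_erase.2 ⟨hzp, hz⟩
      have hzA : (z - p).arg ∈ range e := by
        rw [he, Finset.range_orderEmbOfFin]
        exact Finset.mem_image_of_mem _ hz'
      obtain ⟨i, hi⟩ := hzA
      refine ⟨i.succ, ?_⟩
      rw [Fin.cons_succ]
      exact hinj (hxmem i) hz' ((hxarg i).trans hi)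

/-! ### Support function and Cauchy's formula -/

/-- `normalCoord θ` as a linear functional. -/
def normalFunctional (θ : ℝ) : ℂ →ₗ[ℝ] ℝ where
  toFun := normalCoord θ
  map_add' x y := by
    simp only [normalCoord, Complex.add_re, Complex.add_im]
    ring
  map_smul' r x := by
    simp only [normalCoord, Complex.real_smul, Complex.re_ofReal_mul, Complex.im_ofReal_mul,
      smul_eq_mul, RingHom.id_apply]
    ring

lemma normalFunctional_apply (θ : ℝ) (z : ℂ) : normalFunctional θ z = normalCoord θ z := rfl

lemma normalCoord_sub (θ : ℝ) (y z : ℂ) :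
    normalCoord θ (y - z) = normalCoord θ y - normalCoord θ z :=
  map_sub (normalFunctional θ) y z

lemma normalCoord_add_pi (θ : ℝ) (z : ℂ) : normalCoord (θ + Real.pi) z = -normalCoord θ z := by
  simp only [normalCoord, Real.cos_add_pi, Real.sin_add_pi]
  ring

lemma normalCoord_add_two_pi (θ : ℝ) (z : ℂ) :
    normalCoord (θ + 2 * Real.pi) z = normalCoord θ z := by
  simp only [normalCoord, Real.cos_add_two_pi, Real.sin_add_two_pi]

lemma normalCoord_eq_norm_mul_cos (θ : ℝ) (z : ℂ) :
    normalCoord θ z = ‖z‖ * Real.cos (θ - z.arg) := by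
  rw [normalCoord, Real.cos_sub]
  linear_combination -Real.cos θ * Complex.norm_mul_cos_arg z
    - Real.sin θ * Complex.norm_mul_sin_arg z

lemma abs_normalCoord_le (θ : ℝ) (z : ℂ) : |normalCoord θ z| ≤ ‖z‖ := by
  rw [normalCoord_eq_norm_mul_cos, abs_mul, abs_norm]
  exact mul_le_of_le_one_right (norm_nonneg _) (Real.abs_cos_le_one _)

lemma abs_normalCoord_sub_le (θ θ' : ℝ) (z : ℂ) :
    |normalCoord θ z - normalCoord θ' z| ≤ ‖z‖ * |θ - θ'| := by
  rw [normalCoord_eq_norm_mul_cos, normalCoord_eq_norm_mul_cos, ← mul_sub, abs_mul, abs_norm]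
  refine mul_le_mul_of_nonneg_left ?_ (norm_nonneg _)
  have h := Real.abs_cos_sub_cos_le (θ - z.arg) (θ' - z.arg)
  rwa [sub_sub_sub_cancel_right] at h

lemma integral_abs_cos : ∫ θ in (-Real.pi)..Real.pi, |Real.cos θ| = 4 := by
  have hper : Function.Periodic (fun θ => |Real.cos θ|) (2 * Real.pi) := fun θ => by
    simp only [Real.cos_add_two_pi]
  have hint : ∀ a b, IntervalIntegrable (fun θ => |Real.cos θ|) volume a b := fun a b =>
    Continuous.intervalIntegrable (by fun_prop) a b
  have h := hper.intervalIntegral_add_eq (-Real.pi) (-(Real.pi / 2))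
  rw [show -Real.pi + 2 * Real.pi = Real.pi by ring,
    show -(Real.pi / 2) + 2 * Real.pi = Real.pi / 2 + Real.pi by ring] at h
  rw [h, ← intervalIntegral.integral_add_adjacent_intervals (hint _ (Real.pi / 2)) (hint _ _)]
  have h1 : ∫ θ in (-(Real.pi / 2))..(Real.pi / 2), |Real.cos θ| = 2 := by
    rw [intervalIntegral.integral_congr (g := Real.cos)]
    · rw [integral_cos]
      norm_num
    · intro θ hθ
      rw [uIcc_of_le (by linarith [Real.pi_pos])] at hθ
      exact abs_of_nonneg (Real.cos_nonneg_of_mem_Icc hθ)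
  have h2 : ∫ θ in (Real.pi / 2)..(Real.pi / 2 + Real.pi), |Real.cos θ| = 2 := by
    have h3 := intervalIntegral.integral_comp_add_right (a := -(Real.pi / 2)) (b := Real.pi / 2)
      (fun θ => |Real.cos θ|) Real.pi
    rw [show -(Real.pi / 2) + Real.pi = Real.pi / 2 by ring] at h3
    rw [← h3]
    simpa only [Real.cos_add_pi, abs_neg] using h1
  rw [h1, h2]
  norm_num

/-- The length of a vector is a quarter of the total length of its projections. -/
lemma norm_eq_integral_abs_normalCoord (z : ℂ) :
    ‖z‖ = ∫ θ in (-Real.pi)..Real.pi, |normalCoord θ z| / 4 := by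
  have hper : Function.Periodic (fun θ => |Real.cos θ|) (2 * Real.pi) := fun θ => by
    simp only [Real.cos_add_two_pi]
  have h1 : ∫ θ in (-Real.pi)..Real.pi, |Real.cos (θ - z.arg)| = 4 := by
    rw [intervalIntegral.integral_comp_sub_right (fun θ => |Real.cos θ|), ← integral_abs_cos]
    have h := hper.intervalIntegral_add_eq (-Real.pi - z.arg) (-Real.pi)
    rwa [show -Real.pi - z.arg + 2 * Real.pi = Real.pi - z.arg by ring,
      show -Real.pi + 2 * Real.pi = Real.pi by ring] at h
  simp only [normalCoord_eq_norm_mul_cos, abs_mul, abs_norm, mul_div_assoc]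
  rw [intervalIntegral.integral_const_mul, intervalIntegral.integral_div, h1]
  norm_num

/-- The support function of `X` in the direction of angle `θ`. -/
def supportFn (X : Set ℂ) (θ : ℝ) : ℝ := sSup (normalCoord θ '' X)

section SupportFn

variable {X : Set ℂ}

lemma bddAbove_normalCoord (hX : Bornology.IsBounded X) (θ : ℝ) :
    BddAbove (normalCoord θ '' X) := by
  obtain ⟨C, hC⟩ := hX.exists_norm_le
  refine ⟨C, ?_⟩
  rintro _ ⟨z, hz, rfl⟩
  exact (le_abs_self _).trans ((abs_normalCoord_le θ z).trans (hC z hz))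

lemma normalCoord_le_supportFn (hX : Bornology.IsBounded X) (θ : ℝ) {z : ℂ} (hz : z ∈ X) :
    normalCoord θ z ≤ supportFn X θ :=
  le_csSup (bddAbove_normalCoord hX θ) (mem_image_of_mem _ hz)

lemma supportFn_le (hne : X.Nonempty) {θ c : ℝ} (h : ∀ z ∈ X, normalCoord θ z ≤ c) :
    supportFn X θ ≤ c :=
  csSup_le (hne.image _) (forall_mem_image.2 h)

lemma exists_lt_normalCoord (hne : X.Nonempty) {θ c : ℝ} (h : c < supportFn X θ) :
    ∃ z ∈ X, c < normalCoord θ z := by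
  obtain ⟨_, ⟨z, hz, rfl⟩, hlt⟩ := exists_lt_of_lt_csSup (hne.image _) h
  exact ⟨z, hz, hlt⟩

lemma supportFn_add_two_pi (X : Set ℂ) (θ : ℝ) :
    supportFn X (θ + 2 * Real.pi) = supportFn X θ := by
  simp only [supportFn, normalCoord_add_two_pi, image]

lemma abs_supportFn_le (hne : X.Nonempty) {C : ℝ} (hC : ∀ z ∈ X, ‖z‖ ≤ C) (θ : ℝ) :
    |supportFn X θ| ≤ C := by
  have hb : ∀ z ∈ X, |normalCoord θ z| ≤ C := fun z hz => (abs_normalCoord_le θ z).trans (hC z hz)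
  rw [abs_le]
  constructor
  · obtain ⟨z, hz⟩ := hne
    exact (abs_le.1 (hb z hz)).1.trans
      (normalCoord_le_supportFn (isBounded_iff_forall_norm_le.2 ⟨C, hC⟩) θ hz)
  · exact supportFn_le hne fun z hz => (abs_le.1 (hb z hz)).2

lemma continuous_supportFn (hne : X.Nonempty) (hX : Bornology.IsBounded X) :
    Continuous (supportFn X) := by
  obtain ⟨C, hC⟩ := hX.exists_norm_le
  have hC0 : 0 ≤ C := (norm_nonneg _).trans (hC _ hne.some_mem)
  refine (LipschitzWith.of_le_add_mul ⟨C, hC0⟩ fun θ θ' => ?_).continuous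
  refine supportFn_le hne fun z hz => ?_
  have h1 := normalCoord_le_supportFn hX θ' hz
  have h2 := (abs_le.1 (abs_normalCoord_sub_le θ θ' z)).2
  have h3 := mul_le_mul_of_nonneg_right (hC z hz) (abs_nonneg (θ - θ'))
  rw [Real.dist_eq]
  change _ ≤ _ + C * _
  linarith

lemma supportFn_intervalIntegrable (hne : X.Nonempty) (hX : Bornology.IsBounded X) (a b : ℝ) :
    IntervalIntegrable (supportFn X) volume a b :=
  (continuous_supportFn hne hX).intervalIntegrable a b

lemma intervalIntegral_comp_add_pi {f : ℝ → ℝ} (hf : Function.Periodic f (2 * Real.pi)) :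
    ∫ θ in (-Real.pi)..Real.pi, f (θ + Real.pi) = ∫ θ in (-Real.pi)..Real.pi, f θ := by
  rw [intervalIntegral.integral_comp_add_right f]
  have h := hf.intervalIntegral_add_eq (-Real.pi + Real.pi) (-Real.pi)
  rwa [show -Real.pi + Real.pi + 2 * Real.pi = Real.pi + Real.pi by ring,
    show -Real.pi + 2 * Real.pi = Real.pi by ring] at h

/-- Half-widths, unlike support values, are nonnegative and independent of the origin, so they
compare with projections of polygons. -/
lemma integral_supportFn_eq_width (hne : X.Nonempty) (hX : Bornology.IsBounded X) :
    ∫ θ in (-Real.pi)..Real.pi, supportFn X θ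
      = ∫ θ in (-Real.pi)..Real.pi, (supportFn X θ + supportFn X (θ + Real.pi)) / 2 := by
  have hc := continuous_supportFn hne hX
  rw [intervalIntegral.integral_div, intervalIntegral.integral_add
    (supportFn_intervalIntegrable hne hX _ _)
    (Continuous.intervalIntegrable (by fun_prop) _ _),
    intervalIntegral_comp_add_pi (supportFn_add_two_pi X)]
  ring

lemma neg_le_supportFn_add_pi (hX : Bornology.IsBounded X) (θ : ℝ) {z : ℂ} (hz : z ∈ X) :
    -normalCoord θ z ≤ supportFn X (θ + Real.pi) := by
  rw [← normalCoord_add_pi]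
  exact normalCoord_le_supportFn hX _ hz

lemma width_nonneg (hne : X.Nonempty) (hX : Bornology.IsBounded X) (θ : ℝ) :
    0 ≤ supportFn X θ + supportFn X (θ + Real.pi) := by
  obtain ⟨z, hz⟩ := hne
  linarith [normalCoord_le_supportFn hX θ hz, neg_le_supportFn_add_pi hX θ hz]

lemma integral_supportFn_nonneg (hne : X.Nonempty) (hX : Bornology.IsBounded X) :
    0 ≤ ∫ θ in (-Real.pi)..Real.pi, supportFn X θ := by
  rw [integral_supportFn_eq_width hne hX]
  exact intervalIntegral.integral_nonneg (by linarith [Real.pi_pos]) fun θ _ =>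
    div_nonneg (width_nonneg hne hX θ) zero_le_two

lemma sum_dist_eq_integral {n : ℕ} (x : Fin (n + 1) → ℂ) :
    ∑ i, dist (x i) (x (i + 1)) = ∫ θ in (-Real.pi)..Real.pi,
      (∑ i, |normalCoord θ (x (i + 1)) - normalCoord θ (x i)|) / 4 := by
  simp only [Finset.sum_div]
  rw [intervalIntegral.integral_finsetSum]
  · refine Finset.sum_congr rfl fun i _ => ?_
    rw [dist_comm, dist_eq_norm, norm_eq_integral_abs_normalCoord]
    simp only [normalCoord_sub]
  · intro i _
    refine Continuous.intervalIntegrable ?_ _ _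
    unfold normalCoord
    fun_prop

/-- In each direction the projection of the polygon runs over its range exactly twice, and that
range is at most the width of `X`. -/
lemma IsConvexPolygon.sum_dist_le {n : ℕ} {x : Fin (n + 1) → ℂ} (hx : IsConvexPolygon x)
    (hX : Bornology.IsBounded X) (hxX : ∀ i, x i ∈ X) :
    ∑ i, dist (x i) (x (i + 1)) ≤ ∫ θ in (-Real.pi)..Real.pi, supportFn X θ := by
  have hne : X.Nonempty := ⟨x 0, hxX 0⟩
  have hc := continuous_supportFn hne hX
  rw [sum_dist_eq_integral, integral_supportFn_eq_width hne hX]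
  refine intervalIntegral.integral_mono_on (by linarith [Real.pi_pos])
    (Continuous.intervalIntegrable (by unfold normalCoord; fun_prop) _ _)
    (Continuous.intervalIntegrable (by fun_prop) _ _) fun θ _ => ?_
  obtain ⟨p, q, -, -, hsum⟩ := hx.exists_sum_abs_sub_eq (normalFunctional θ)
  simp only [normalFunctional_apply] at hsum
  rw [hsum]
  linarith [normalCoord_le_supportFn hX θ (hxX p), neg_le_supportFn_add_pi hX θ (hxX q)]

lemma IsConvexPolygon.le_sum_dist {n : ℕ} {x : Fin (n + 1) → ℂ} (hx : IsConvexPolygon x)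
    (hne : X.Nonempty) (hX : X ⊆ convexHull ℝ (range x)) :
    ∫ θ in (-Real.pi)..Real.pi, supportFn X θ ≤ ∑ i, dist (x i) (x (i + 1)) := by
  have hbdd : Bornology.IsBounded X :=
    (isBounded_convexHull.2 (finite_range x).isBounded).subset hX
  have hc := continuous_supportFn hne hbdd
  rw [sum_dist_eq_integral, integral_supportFn_eq_width hne hbdd]
  refine intervalIntegral.integral_mono_on (by linarith [Real.pi_pos])
    (Continuous.intervalIntegrable (by fun_prop) _ _)
    (Continuous.intervalIntegrable (by unfold normalCoord; fun_prop) _ _) fun θ _ => ?_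
  obtain ⟨p, q, hp, hq, hsum⟩ := hx.exists_sum_abs_sub_eq (normalFunctional θ)
  simp only [normalFunctional_apply] at hsum hp hq
  rw [hsum]
  have h1 : supportFn X θ ≤ normalCoord θ (x p) := supportFn_le hne fun z hz =>
    convexHull_min (t := {z | normalCoord θ z ≤ normalCoord θ (x p)})
      (range_subset_iff.2 hp) (convex_halfSpace_le (normalFunctional θ).isLinear _) (hX hz)
  have h2 : supportFn X (θ + Real.pi) ≤ -normalCoord θ (x q) := supportFn_le hne fun z hz => by
    rw [normalCoord_add_pi, neg_le_neg_iff]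
    exact convexHull_min (t := {z | normalCoord θ (x q) ≤ normalCoord θ z})
      (range_subset_iff.2 hq) (convex_halfSpace_ge (normalFunctional θ).isLinear _) (hX hz)
  linarith

/-- Initial stretches of a dense sequence suffice, since `normalCoord θ` is continuous. -/
lemma exists_finset_tendsto_supportFn (hne : X.Nonempty) (hX : Bornology.IsBounded X) :
    ∃ F : ℕ → Finset ℂ, (∀ k, (F k).Nonempty) ∧ (∀ k, (F k : Set ℂ) ⊆ X) ∧
      ∀ θ, Tendsto (fun k => supportFn (F k) θ) atTop (𝓝 (supportFn X θ)) := by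
  classical
  have : Nonempty X := hne.to_subtype
  set d : ℕ → X := TopologicalSpace.denseSeq X with hd
  set F : ℕ → Finset ℂ := fun k => (Finset.range (k + 1)).image fun m => (d m : ℂ) with hF
  have hFne : ∀ k, (F k).Nonempty := fun k => Finset.Nonempty.image ⟨0, by simp⟩ _
  have hFX : ∀ k, (F k : Set ℂ) ⊆ X := fun k z hz => by
    obtain ⟨m, -, rfl⟩ := Finset.mem_image.1 hz
    exact (d m).2
  refine ⟨F, hFne, hFX, fun θ => tendsto_order.2 ⟨fun c hc => ?_, fun c hc => ?_⟩⟩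
  · obtain ⟨z, hz, hlt⟩ := exists_lt_normalCoord hne hc
    have hopen : IsOpen {y : X | c < normalCoord θ y} :=
      isOpen_lt continuous_const (by unfold normalCoord; fun_prop)
    obtain ⟨m, hm⟩ := (TopologicalSpace.denseRange_denseSeq X).exists_mem_open hopen ⟨⟨z, hz⟩, hlt⟩
    filter_upwards [eventually_ge_atTop m] with k hk
    refine lt_of_lt_of_le hm (normalCoord_le_supportFn (F k).finite_toSet.isBounded θ ?_)
    exact Finset.mem_image.2 ⟨m, by simpa using Nat.lt_succ_of_le hk, rfl⟩
  · refine Eventually.of_forall fun k => lt_of_le_of_lt ?_ hc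
    exact supportFn_le (hFne k) fun z hz => normalCoord_le_supportFn hX θ (hFX k hz)

/-- **Cauchy's formula**: the perimeter is the integral of the support function. -/
theorem perimeter_eq_integral (hne : X.Nonempty) (hX : Bornology.IsBounded X) :
    perimeter X = ∫ θ in (-Real.pi)..Real.pi, supportFn X θ := by
  have hedist : ∀ {n : ℕ} (x : Fin (n + 1) → ℂ),
      ∑ i, edist (x i) (x (i + 1)) = ENNReal.ofReal (∑ i, dist (x i) (x (i + 1))) := fun x => by
    rw [ENNReal.ofReal_sum_of_nonneg fun i _ => dist_nonneg]
    simp only [edist_dist]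
  rw [perimeter, ← ENNReal.toReal_ofReal (integral_supportFn_nonneg hne hX)]
  congr 1
  refine le_antisymm ?_ ?_
  · refine iSup_le fun n => iSup_le fun x => iSup_le fun hxX => iSup_le fun hx => ?_
    rw [hedist]
    exact ENNReal.ofReal_le_ofReal (hx.sum_dist_le hX hxX)
  -- Each finite set is spanned by a convex polygon with vertices in `X`, at least as long as the
  -- integral for that set.
  · obtain ⟨F, hFne, hFX, hlim⟩ := exists_finset_tendsto_supportFn hne hX
    obtain ⟨C, hC⟩ := hX.exists_norm_le
    have htend : Tendsto (fun k => ∫ θ in (-Real.pi)..Real.pi, supportFn (F k) θ) atTop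
        (𝓝 (∫ θ in (-Real.pi)..Real.pi, supportFn X θ)) := by
      refine intervalIntegral.tendsto_integral_filter_of_dominated_convergence (fun _ => C)
        (Eventually.of_forall fun k =>
          (continuous_supportFn (hFne k) (F k).finite_toSet.isBounded).aestronglyMeasurable)
        (Eventually.of_forall fun k => Eventually.of_forall fun θ _ =>
          abs_supportFn_le (hFne k) (fun z hz => hC z (hFX k hz)) θ)
        intervalIntegrable_const (Eventually.of_forall fun θ _ => hlim θ)
    refine le_of_tendsto ((ENNReal.continuous_ofReal.tendsto _).comp htend)
      (Eventually.of_forall fun k => ?_)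
    obtain ⟨n, x, hxF, hx, hcov⟩ := exists_isConvexPolygon (F k) (hFne k)
    refine (ENNReal.ofReal_le_ofReal (hx.le_sum_dist (hFne k) hcov)).trans ?_
    rw [← hedist]
    exact le_iSup_of_le n (le_iSup_of_le x (le_iSup_of_le (fun i => hFX k (hxF i))
      (le_iSup_of_le hx le_rfl)))

end SupportFn

/-! ### The measure of sets of directional lines -/

lemma lineMeasure_apply {S : Set DirLine} (hS : MeasurableSet S) :
    lineMeasure S = ∫⁻ θ in Icc (-Real.pi) Real.pi,
      2⁻¹ * (volume ({ρ : ℝ | (ρ, θ, true) ∈ S} ∩ Ici 0)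
        + volume ({ρ : ℝ | (ρ, θ, false) ∈ S} ∩ Ici 0)) := by
  rw [lineMeasure, Measure.prod_apply_symm hS,
    lintegral_prod _ (measurable_measure_prodMk_right hS).aemeasurable]
  refine lintegral_congr fun θ => ?_
  rw [lintegral_smul_measure, lintegral_count, tsum_fintype, Fintype.sum_bool, smul_eq_mul,
    Measure.restrict_apply' measurableSet_Ici, Measure.restrict_apply' measurableSet_Ici]
  rfl

lemma lineMeasure_eq_ofReal {S : Set DirLine} (hS : MeasurableSet S) {u v : ℝ → ℝ}
    (hu : Continuous u) (hv : Continuous v) (hu0 : ∀ θ, 0 ≤ u θ) (hv0 : ∀ θ, 0 ≤ v θ)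
    (hSu : ∀ θ, volume ({ρ : ℝ | (ρ, θ, true) ∈ S} ∩ Ici 0) = ENNReal.ofReal (u θ))
    (hSv : ∀ θ, volume ({ρ : ℝ | (ρ, θ, false) ∈ S} ∩ Ici 0) = ENNReal.ofReal (v θ)) :
    lineMeasure S = ENNReal.ofReal (∫ θ in (-Real.pi)..Real.pi, (u θ + v θ) / 2) := by
  have hc : Continuous fun θ => (u θ + v θ) / 2 := by fun_prop
  rw [lineMeasure_apply hS, intervalIntegral.integral_of_le (by linarith [Real.pi_pos]),
    ← integral_Icc_eq_integral_Ioc, ofReal_integral_eq_lintegral_ofReal]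
  · refine lintegral_congr fun θ => ?_
    rw [hSu, hSv, ← ENNReal.ofReal_add (hu0 θ) (hv0 θ), div_eq_inv_mul,
      ENNReal.ofReal_mul (by norm_num), ENNReal.ofReal_inv_of_pos two_pos, ENNReal.ofReal_ofNat]
  · exact hc.continuousOn.integrableOn_Icc
  · exact Eventually.of_forall fun θ => div_nonneg (add_nonneg (hu0 θ) (hv0 θ)) zero_le_two

/-- Restricting to `ρ ≥ 0` turns lengths into differences of positive parts, wherever the origin
lies. -/
lemma volume_Icc_max_zero {a b : ℝ} (hab : a ≤ b) :
    volume (Icc (max a 0) b) = ENNReal.ofReal (max b 0 - max a 0) := by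
  rw [Real.volume_Icc]
  rcases le_total 0 b with hb | hb
  · rw [max_eq_left hb]
  · rw [max_eq_right hb, max_eq_right (hab.trans hb), sub_zero, sub_self,
      ENNReal.ofReal_of_nonpos hb, ENNReal.ofReal_zero]

section Lines

variable {X K : Set ℂ}

/-- The directional lines whose distance from the origin lies between the support lines of `X`. -/
def hitBand (X : Set ℂ) : Set DirLine :=
  {G | -supportFn X (G.2.1 + Real.pi) ≤ G.1 ∧ G.1 ≤ supportFn X G.2.1}

/-- The directional lines whose right half-plane misses `K`. -/
def avoiding (K : Set ℂ) : Set DirLine := {G | Disjoint K G.right}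

lemma isClosed_hitBand (hne : X.Nonempty) (hX : Bornology.IsBounded X) :
    IsClosed (hitBand X) := by
  have hc := continuous_supportFn hne hX
  have h1 : IsClosed {G : DirLine | -supportFn X (G.2.1 + Real.pi) ≤ G.1} :=
    isClosed_le (by fun_prop) (by fun_prop)
  have h2 : IsClosed {G : DirLine | G.1 ≤ supportFn X G.2.1} :=
    isClosed_le (by fun_prop) (by fun_prop)
  exact h1.inter h2

lemma isClosed_avoiding (K : Set ℂ) : IsClosed (avoiding K) := by
  have h : avoiding K = ⋂ z ∈ K, {G : DirLine | z ∉ G.right} := by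
    ext G
    simp [avoiding, disjoint_left]
  rw [h]
  refine isClosed_biInter fun z _ => ?_
  have h' : {G : DirLine | z ∉ G.right} =
      {G | normalCoord G.2.1 z ≤ G.1 ∧ G.2.2 = true} ∪
        {G | G.1 ≤ normalCoord G.2.1 z ∧ G.2.2 = false} := by
    ext ⟨ρ, θ, b⟩
    cases b <;> simp [DirLine.right]
  rw [h']
  have hn : Continuous fun G : DirLine => normalCoord G.2.1 z := by
    unfold normalCoord
    fun_prop
  exact ((isClosed_le hn continuous_fst).inter
    (isClosed_eq (by fun_prop) continuous_const)).union
    ((isClosed_le continuous_fst hn).inter (isClosed_eq (by fun_prop) continuous_const))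

/-- With `h` the support function, a fibre has length `h(θ)⁺ - (-h(θ + π))⁺`. Shifting the second
term by `π` turns the integrand into `h⁺ - h⁻ = h`. -/
lemma lineMeasure_hitBand (hne : X.Nonempty) (hX : Bornology.IsBounded X) :
    lineMeasure (hitBand X)
      = ENNReal.ofReal (∫ θ in (-Real.pi)..Real.pi, supportFn X θ) := by
  have hc := continuous_supportFn hne hX
  have hle : ∀ θ, -supportFn X (θ + Real.pi) ≤ supportFn X θ := fun θ => by
    linarith [width_nonneg hne hX θ]
  have hfib : ∀ (b : Bool) (θ : ℝ), volume ({ρ : ℝ | (ρ, θ, b) ∈ hitBand X} ∩ Ici 0)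
      = ENNReal.ofReal (max (supportFn X θ) 0 - max (-supportFn X (θ + Real.pi)) 0) :=
    fun b θ => by
      rw [← volume_Icc_max_zero (hle θ)]
      congr 1
      ext ρ
      simp only [hitBand, mem_inter_iff, mem_ofPred_eq, mem_Ici, mem_Icc, max_le_iff]
      tauto
  have hnn : ∀ θ, 0 ≤ max (supportFn X θ) 0 - max (-supportFn X (θ + Real.pi)) 0 := fun θ =>
    sub_nonneg.2 (max_le_max_right 0 (hle θ))
  rw [lineMeasure_eq_ofReal (isClosed_hitBand hne hX).measurableSet (by fun_prop) (by fun_prop)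
    hnn hnn (hfib true) (hfib false)]
  congr 1
  have hper : Function.Periodic (fun θ => max (-supportFn X θ) 0) (2 * Real.pi) := fun θ => by
    simp only [supportFn_add_two_pi]
  simp only [add_self_div_two]
  rw [intervalIntegral.integral_sub (Continuous.intervalIntegrable (by fun_prop) _ _)
    (Continuous.intervalIntegrable (by fun_prop) _ _), intervalIntegral_comp_add_pi hper,
    ← intervalIntegral.integral_sub (Continuous.intervalIntegrable (by fun_prop) _ _)
    (Continuous.intervalIntegrable (by fun_prop) _ _)]
  refine intervalIntegral.integral_congr fun θ _ => ?_
  exact max_zero_sub_max_neg_zero_eq_self _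

/-- One direction gives the lines between the upper supports of `K` and `X`, the other those between
the lower supports. Their positive parts recombine as for `hitBand`; the half is the weight of a
direction. -/
lemma lineMeasure_avoiding_inter_hitBand (hK : K.Nonempty) (hKX : K ⊆ X)
    (hX : Bornology.IsBounded X) :
    lineMeasure (avoiding K ∩ hitBand X)
      = ENNReal.ofReal (((∫ θ in (-Real.pi)..Real.pi, supportFn X θ)
        - ∫ θ in (-Real.pi)..Real.pi, supportFn K θ) / 2) := by
  have hne := hK.mono hKX
  have hKb := hX.subset hKX
  have hc := continuous_supportFn hne hX
  have hcK := continuous_supportFn hK hKb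
  have hle : ∀ θ, supportFn K θ ≤ supportFn X θ := fun θ =>
    supportFn_le hK fun z hz => normalCoord_le_supportFn hX θ (hKX hz)
  have hw : ∀ θ, -supportFn K (θ + Real.pi) ≤ supportFn K θ := fun θ => by
    linarith [width_nonneg hK hKb θ]
  rw [lineMeasure_eq_ofReal (u := fun θ => max (supportFn X θ) 0 - max (supportFn K θ) 0)
    (v := fun θ => max (-supportFn K (θ + Real.pi)) 0 - max (-supportFn X (θ + Real.pi)) 0)
    ((isClosed_avoiding K).inter (isClosed_hitBand hne hX)).measurableSet
    (by fun_prop) (by fun_prop) (fun θ => sub_nonneg.2 (max_le_max_right 0 (hle θ)))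
    (fun θ => sub_nonneg.2 (max_le_max_right 0 (neg_le_neg (hle _))))]
  · congr 1
    have hper : ∀ Z : Set ℂ, Function.Periodic (fun θ => max (-supportFn Z θ) 0) (2 * Real.pi) :=
      fun Z θ => by simp only [supportFn_add_two_pi]
    have hii : ∀ {f : ℝ → ℝ}, Continuous f →
        IntervalIntegrable f volume (-Real.pi) Real.pi := fun hf => hf.intervalIntegrable _ _
    have hsplit : ∀ Z : Set ℂ, Continuous (supportFn Z) →
        ∫ θ in (-Real.pi)..Real.pi, supportFn Z θ
          = (∫ θ in (-Real.pi)..Real.pi, max (supportFn Z θ) 0)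
            - ∫ θ in (-Real.pi)..Real.pi, max (-supportFn Z (θ + Real.pi)) 0 := fun Z hZ => by
      rw [intervalIntegral_comp_add_pi (hper Z), ← intervalIntegral.integral_sub
        (hii (by fun_prop)) (hii (by fun_prop))]
      exact intervalIntegral.integral_congr fun θ _ => (max_zero_sub_max_neg_zero_eq_self _).symm
    rw [intervalIntegral.integral_div, intervalIntegral.integral_add (hii (by fun_prop))
      (hii (by fun_prop)), intervalIntegral.integral_sub (hii (by fun_prop)) (hii (by fun_prop)),
      intervalIntegral.integral_sub (hii (by fun_prop)) (hii (by fun_prop)), hsplit X hc,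
      hsplit K hcK]
    ring
  · intro θ
    rw [← volume_Icc_max_zero (hle θ)]
    congr 1
    ext ρ
    have h1 : (ρ, θ, true) ∈ avoiding K ↔ supportFn K θ ≤ ρ := by
      simp only [avoiding, DirLine.right, disjoint_left, mem_ofPred_eq, if_true, not_lt]
      exact ⟨supportFn_le hK, fun h z hz => (normalCoord_le_supportFn hKb θ hz).trans h⟩
    simp only [hitBand, mem_inter_iff, mem_ofPred_eq, mem_Ici, mem_Icc, max_le_iff] at h1 ⊢
    rw [h1]
    have := hw θ
    have := hle (θ + Real.pi)
    constructor
    · rintro ⟨⟨h, h', h''⟩, h0⟩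
      exact ⟨⟨h, h0⟩, h''⟩
    · rintro ⟨⟨h, h0⟩, h'⟩
      exact ⟨⟨h, by linarith, h'⟩, h0⟩
  · intro θ
    rw [← volume_Icc_max_zero (neg_le_neg (hle _))]
    congr 1
    ext ρ
    have h1 : (ρ, θ, false) ∈ avoiding K ↔ ρ ≤ -supportFn K (θ + Real.pi) := by
      simp only [avoiding, DirLine.right, disjoint_left, mem_ofPred_eq, Bool.false_eq_true,
        if_false, not_lt]
      rw [le_neg]
      constructor
      · intro h
        refine supportFn_le hK fun z hz => ?_
        rw [normalCoord_add_pi, neg_le_neg_iff]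
        exact h hz
      · intro h z hz
        linarith [neg_le_supportFn_add_pi hKb θ hz]
    simp only [hitBand, mem_inter_iff, mem_ofPred_eq, mem_Ici, mem_Icc, max_le_iff] at h1 ⊢
    rw [h1]
    have := hw θ
    have := hle θ
    constructor
    · rintro ⟨⟨h, h', h''⟩, h0⟩
      exact ⟨⟨h', h0⟩, h⟩
    · rintro ⟨⟨h, h0⟩, h'⟩
      exact ⟨⟨h', h, by linarith⟩, h0⟩

lemma lineMeasure_graph {φ : ℝ → ℝ} (hφ : Continuous φ) :
    lineMeasure {G : DirLine | G.1 = φ G.2.1} = 0 := by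
  have hfib : ∀ (b : Bool) (θ : ℝ),
      volume ({ρ : ℝ | (ρ, θ, b) ∈ {G : DirLine | G.1 = φ G.2.1}} ∩ Ici 0)
        = ENNReal.ofReal 0 := fun b θ => by
    rw [ENNReal.ofReal_zero]
    refine measure_mono_null inter_subset_left ?_
    exact Real.volume_singleton (a := φ θ)
  rw [lineMeasure_eq_ofReal (u := fun _ => 0) (v := fun _ => 0)
    (isClosed_eq (by fun_prop) (by fun_prop)).measurableSet continuous_const continuous_const
    (fun _ => le_rfl) (fun _ => le_rfl) (hfib true) (hfib false)]
  simp

/-- The lines that meet a bounded convex set are, up to a null set, those between its support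
lines. -/
lemma hit_ae_eq_hitBand (hne : X.Nonempty) (hX : Bornology.IsBounded X) (hconv : Convex ℝ X) :
    {G : DirLine | (G.points ∩ X).Nonempty} =ᵐ[lineMeasure] hitBand X := by
  have hc := continuous_supportFn hne hX
  -- Only the support lines are undecided, as `X` need not be closed; they form two graphs over `θ`.
  have hnull : lineMeasure ({G : DirLine | G.1 = supportFn X G.2.1} ∪
      {G | G.1 = -supportFn X (G.2.1 + Real.pi)}) = 0 :=
    measure_union_null (lineMeasure_graph hc)
      (lineMeasure_graph (φ := fun θ => -supportFn X (θ + Real.pi)) (by fun_prop))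
  have hae : ∀ᵐ G ∂lineMeasure, G ∉ ({G : DirLine | G.1 = supportFn X G.2.1} ∪
      {G | G.1 = -supportFn X (G.2.1 + Real.pi)}) := measure_eq_zero_iff_ae_notMem.1 hnull
  filter_upwards [hae] with G hG
  obtain ⟨ρ, θ, b⟩ := G
  simp only [mem_union, mem_ofPred_eq, not_or] at hG
  refine propext ⟨?_, fun h => ?_⟩
  · rintro ⟨z, hz, hzX⟩
    have hz' : normalCoord θ z = ρ := hz
    have h1 := normalCoord_le_supportFn hX θ hzX
    have h2 := neg_le_supportFn_add_pi hX θ hzX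
    exact ⟨by simp only; linarith, by simp only; linarith⟩
  · have h1 : ρ < supportFn X θ := lt_of_le_of_ne h.2 hG.1
    have h2 : -supportFn X (θ + Real.pi) < ρ := lt_of_le_of_ne h.1 (Ne.symm hG.2)
    obtain ⟨y, hy, hyρ⟩ := exists_lt_normalCoord hne h1
    obtain ⟨z, hz, hzρ⟩ := exists_lt_normalCoord hne (neg_lt.1 h2)
    rw [normalCoord_add_pi, neg_lt_neg_iff] at hzρ
    have hcont : ContinuousOn (normalCoord θ) X := by
      unfold normalCoord
      fun_prop
    obtain ⟨x, hx, hxρ⟩ := hconv.isPreconnected.intermediate_value hz hy hcont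
      ⟨hzρ.le, hyρ.le⟩
    exact ⟨x, hxρ, hx⟩

end Lines

/-! ### The weakest arrangement -/

section Weakest

variable {ι : Type*} {N : Network ι} {s t : ℂ}

lemma DirLine.exists_right_eq (G : DirLine) :
    ∃ (w : ℂ) (ρ : ℝ), G.right = {z | ρ < (w * z).re} := by
  obtain ⟨ρ, θ, b⟩ := G
  cases b
  · refine ⟨-⟨Real.cos θ, -Real.sin θ⟩, -ρ, ?_⟩
    ext z
    simp only [DirLine.right, normalCoord, mem_ofPred_eq, Bool.false_eq_true, if_false,
      neg_mul, Complex.neg_re, Complex.mul_re]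
    rw [neg_lt_neg_iff]
    ring_nf
  · refine ⟨⟨Real.cos θ, -Real.sin θ⟩, ρ, ?_⟩
    ext z
    simp only [DirLine.right, normalCoord, mem_ofPred_eq, if_true, Complex.mul_re]
    ring_nf

lemma DirLine.isOpen_right (G : DirLine) : IsOpen G.right := by
  obtain ⟨w, ρ, h⟩ := G.exists_right_eq
  rw [h]
  exact isOpen_lt continuous_const (by fun_prop)

lemma DirLine.convex_compl_right (G : DirLine) : Convex ℝ (G.right)ᶜ := by
  obtain ⟨w, ρ, h⟩ := G.exists_right_eq
  rw [h, compl_ofPred]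
  simpa only [not_lt] using convex_halfPlane w ρ

/-- The distance of two values is at most the variation between them, so `f` is 1-Lipschitz. -/
lemma HasUnitSpeedOn.continuousOn {f : ℝ → ℂ} {S : Set ℝ} (h : HasUnitSpeedOn f S) :
    ContinuousOn f S := by
  have hle : ∀ x ∈ S, ∀ y ∈ S, x ≤ y → edist (f x) (f y) ≤ edist x y := fun x hx y hy hxy => by
    have h1 := eVariationOn.edist_le f (s := S ∩ Icc x y) ⟨hx, le_rfl, hxy⟩ ⟨hy, hxy, le_rfl⟩
    rw [h hx hy] at h1
    refine h1.trans_eq ?_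
    rw [edist_comm, edist_dist, Real.dist_eq, abs_of_nonneg (sub_nonneg.2 hxy)]
    simp
  have hlip : LipschitzOnWith 1 f S := fun x hx y hy => by
    rw [ENNReal.coe_one, one_mul]
    rcases le_total x y with hxy | hxy
    · exact hle x hx y hy hxy
    · rw [edist_comm, edist_comm x]
      exact hle y hy x hx hxy
  exact hlip.continuousOn

lemma Network.weakParts_subset (N : Network ι) (r ε : ℝ) (e : ι) :
    N.weakParts r ε e ⊆ N.trace e :=
  image_mono fun _ hu => hu.1

/-- The unprotected parts become dense in a link. -/
lemma Network.eventually_weakParts_inter (N : Network ι) {r : ℝ} (hr₀ : 0 < r) (hr₁ : r < 1)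
    {e : ι} {D : Set ℂ} (hD : IsOpen D) (h : ¬ Disjoint (N.trace e) D) :
    ∀ᶠ ε in 𝓝[>] (0 : ℝ), ¬ Disjoint (N.weakParts r ε e) D := by
  obtain ⟨_, ⟨u₀, hu₀, rfl⟩, huD⟩ := not_disjoint_iff.1 h
  have hcont := HasUnitSpeedOn.continuousOn (N.unitSpeed e) u₀ hu₀
  obtain ⟨δ, hδ, hball⟩ := Metric.mem_nhdsWithin_iff.1 (hcont (hD.mem_nhds huD))
  -- A one-sided interval is used because `u₀` may be an end of the link.
  obtain ⟨a, b, hab, hsub⟩ : ∃ a b, a < b ∧ Icc a b ⊆ Metric.ball u₀ δ ∩ Icc 0 (N.len e) := by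
    have hlen := N.len_pos e
    rcases hu₀.2.lt_or_eq with hlt | heq
    · refine ⟨u₀, min (u₀ + δ / 2) (N.len e), lt_min (by linarith) hlt, fun u hu => ?_⟩
      have h1 := le_min_iff.1 hu.2
      exact ⟨by rw [Metric.mem_ball, Real.dist_eq, abs_of_nonneg] <;> linarith [hu.1],
        hu₀.1.trans hu.1, h1.2⟩
    · refine ⟨max (u₀ - δ / 2) 0, u₀, max_lt (by linarith) (by linarith), fun u hu => ?_⟩
      have h1 := max_le_iff.1 hu.1
      exact ⟨by rw [Metric.mem_ball, Real.dist_eq, abs_of_nonpos] <;> linarith [hu.2],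
        h1.2, hu.2.trans hu₀.2⟩
  have hev : ∀ᶠ ε in 𝓝[>] (0 : ℝ), ε < (b - a) / 2 :=
    mem_nhdsWithin_of_mem_nhds (Iio_mem_nhds (by linarith))
  filter_upwards [self_mem_nhdsWithin, hev] with ε hε hεab
  rw [mem_Ioi] at hε
  -- The first period starting at or after `a` is taken; its unprotected part begins at `(k + r) *
  -- ε`, inside `[a, b]` since `2 * ε < b - a`.
  set k := ⌈a / ε⌉ with hk
  have hk1 : a ≤ k * ε := (div_le_iff₀ hε).1 (Int.le_ceil _)
  have hk2 : k * ε < a + ε := by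
    have := mul_lt_mul_of_pos_right (Int.ceil_lt_add_one (a / ε)) hε
    rwa [add_mul, div_mul_cancel₀ _ hε.ne', one_mul] at this
  have hrε : 0 < r * ε := mul_pos hr₀ hε
  have hrε' : r * ε < ε := by nlinarith
  have hmem : (k + r) * ε ∈ Icc a b := ⟨by nlinarith, by nlinarith⟩
  refine not_disjoint_iff.2 ⟨N.curve e ((k + r) * ε), ⟨_, ⟨(hsub hmem).2, ?_⟩, rfl⟩,
    hball (hsub hmem)⟩
  rw [mul_div_cancel_right₀ _ hε.ne', Int.fract_intCast_add, Int.fract_eq_self.2 ⟨hr₀.le, hr₁⟩]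

/-- Finiteness of the set of links gives one threshold for all of them. It depends on `D`, so the
convergence is only pointwise in `G`. -/
lemma Network.eventually_connected_iff [Finite ι] (N : Network ι) {r : ℝ} (hr₀ : 0 < r)
    (hr₁ : r < 1) {D : Set ℂ} (hD : IsOpen D) :
    ∀ᶠ ε in 𝓝[>] (0 : ℝ),
      (N.Connected s t r ε D ↔ ∃ γ : Path s t, N.IsRoute γ ∧ Disjoint (range γ) D) := by
  have h : ∀ᶠ ε in 𝓝[>] (0 : ℝ),
      ∀ e, ¬ Disjoint (N.trace e) D → ¬ Disjoint (N.weakParts r ε e) D := by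
    rw [eventually_all]
    intro e
    rw [eventually_imp_distrib_left]
    exact N.eventually_weakParts_inter hr₀ hr₁ hD
  filter_upwards [h] with ε hε
  constructor
  · rintro ⟨S, γ, hγ, hS⟩
    refine ⟨γ, ⟨S, hγ⟩, ?_⟩
    rw [hγ.2, disjoint_iUnion₂_left]
    exact fun e he => not_imp_not.1 (hε e) (hS e he)
  · rintro ⟨γ, ⟨S, hγ⟩, hdis⟩
    refine ⟨S, γ, hγ, fun e he => hdis.mono_left ?_⟩
    rw [hγ.2]
    exact (N.weakParts_subset r ε e).trans (subset_biUnion_of_mem (u := N.trace) he)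

lemma Network.measurableSet_connected [Finite ι] (N : Network ι) (s t : ℂ) (r ε : ℝ) :
    MeasurableSet {G : DirLine | N.Connected s t r ε G.right} := by
  have h : {G : DirLine | N.Connected s t r ε G.right} =
      ⋃ S ∈ {S : Set ι | ∃ γ : Path s t, N.IsRouteVia S γ},
        ⋂ e ∈ S, avoiding (N.weakParts r ε e) := by
    ext G
    simp only [Network.Connected, avoiding, mem_iUnion, mem_iInter, mem_ofPred_eq, exists_prop]
    exact ⟨fun ⟨S, γ, h, h'⟩ => ⟨S, ⟨γ, h⟩, h'⟩, fun ⟨S, ⟨γ, h⟩, h'⟩ => ⟨S, γ, h, h'⟩⟩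
  rw [h]
  refine MeasurableSet.biUnion (Set.toFinite _).countable fun S _ => ?_
  exact MeasurableSet.biInter (Set.toFinite _).countable fun e _ =>
    (isClosed_avoiding _).measurableSet

lemma IsInnerPlusSegments.exists_route_disjoint_iff {O₁ O₂ : Path s t} (hO : N.IsOuterPair O₁ O₂)
    (hI : IsInnerPlusSegments O₁ O₂) (G : DirLine) :
    (∃ γ : Path s t, N.IsRoute γ ∧ Disjoint (range γ) G.right) ↔
      G ∈ avoiding (convexHull ℝ (inner O₁ O₂ ∪ segment ℝ s t)) := by
  have hconv : G ∈ avoiding (convexHull ℝ (inner O₁ O₂ ∪ segment ℝ s t)) ↔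
      Disjoint (inner O₁ O₂ ∪ segment ℝ s t) G.right := by
    rw [avoiding, mem_ofPred_eq, ← subset_compl_iff_disjoint_right,
      ← subset_compl_iff_disjoint_right]
    exact G.convex_compl_right.convexHull_subset_iff
  rw [hconv]
  obtain ⟨w, ρ, h⟩ := G.exists_right_eq
  simp only [h, disjoint_left, mem_ofPred_eq, not_lt, forall_mem_range]
  exact exists_route_iff hO hI w ρ

lemma Network.IsRoute.range_subset {Ω : Set ℂ} (hN : ∀ e, N.trace e ⊆ Ω) {γ : Path s t}
    (hγ : N.IsRoute γ) : range γ ⊆ Ω := by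
  obtain ⟨S, -, h⟩ := hγ
  rw [h]
  exact iUnion₂_subset fun e _ => hN e

/-- The weakest arrangement, if `O₁` is the union of its inner part and of segments. -/
theorem weakestConnProb_of_isInnerPlusSegments [Finite ι] {Ω : Set ℂ} (hΩ : Convex ℝ Ω)
    (hΩb : Bornology.IsBounded Ω) (hN : ∀ e, N.trace e ⊆ Ω) {O₁ O₂ : Path s t}
    (hO : N.IsOuterPair O₁ O₂) (hsep : InnerPartsSeparated O₁ O₂)
    (hI : IsInnerPlusSegments O₁ O₂) {r : ℝ} (hr₀ : 0 < r) (hr₁ : r < 1) :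
    N.WeakestConnProb Ω s t r
      ((perimeter Ω + perimeter (segment ℝ s t)
          - (perimeter (convexHull ℝ (inner O₁ O₂ ∪ segment ℝ s t))
            + perimeter (convexHull ℝ (inner O₂ O₁ ∪ segment ℝ s t))))
        / (2 * perimeter Ω)) := by
  have hinj₂ : Function.Injective O₂ := hO.route₂.choose_spec.1
  have hst : s ≠ t := fun h => zero_ne_one (α := I)
    (hinj₂ (O₂.source.trans (h.trans O₂.target.symm)))
  have hmeet : range O₁ ∩ range O₂ = {s, t} := by
    rw [inter_comm]
    exact hO.meet₁ O₂ hO.route₂ hO.range_ne.symm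
  have hempty := inner_eq_empty hinj₂ hst hmeet hsep hI
  -- The second hull is the segment, so its perimeter cancels the term of `l(s,t)`.
  rw [hempty, empty_union, (convex_segment s t).convexHull_eq]
  set K := convexHull ℝ (inner O₁ O₂ ∪ segment ℝ s t) with hK
  have hOΩ := hO.route₁.range_subset hN
  have hsΩ : s ∈ Ω := hOΩ ⟨0, O₁.source⟩
  have htΩ : t ∈ Ω := hOΩ ⟨1, O₁.target⟩
  have hKΩ : K ⊆ Ω := convexHull_min
    (union_subset (fun z hz => hOΩ hz.1) (hΩ.segment_subset hsΩ htΩ)) hΩ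
  have hKne : K.Nonempty :=
    ⟨s, subset_convexHull ℝ _ (Or.inr (left_mem_segment ℝ s t))⟩
  have hΩne : Ω.Nonempty := ⟨s, hsΩ⟩
  have hcongr : ∀ X : Set DirLine,
      lineMeasure (X ∩ {G | (G.points ∩ Ω).Nonempty}) = lineMeasure (X ∩ hitBand Ω) := fun X =>
    measure_congr ((ae_eq_refl X).inter (hit_ae_eq_hitBand hΩne hΩb hΩ))
  have hlim : Tendsto (fun ε => lineMeasure
      ({G : DirLine | N.Connected s t r ε G.right} ∩ hitBand Ω)) (𝓝[>] 0)
      (𝓝 (lineMeasure (avoiding K ∩ hitBand Ω))) := by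
    have hm := (isClosed_hitBand hΩne hΩb).measurableSet
    -- For each `G` the indicator is eventually constant in the mesh, and `hitBand Ω` is a
    -- dominating set of finite measure.
    refine tendsto_measure_of_ae_tendsto_indicator (𝓝[>] (0 : ℝ))
      ((isClosed_avoiding K).measurableSet.inter hm)
      (fun ε => (N.measurableSet_connected s t r ε).inter hm) hm ?_
      (Eventually.of_forall fun ε => inter_subset_right) (Eventually.of_forall fun G => ?_)
    · rw [lineMeasure_hitBand hΩne hΩb]
      exact ENNReal.ofReal_ne_top
    · filter_upwards [N.eventually_connected_iff (s := s) (t := t) hr₀ hr₁ G.isOpen_right]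
        with ε hε
      rw [mem_inter_iff, mem_inter_iff, ← hI.exists_route_disjoint_iff hO G, ← hε]
      rfl
  have hnum : 0 ≤ ((∫ θ in (-Real.pi)..Real.pi, supportFn Ω θ)
      - ∫ θ in (-Real.pi)..Real.pi, supportFn K θ) / 2 := by
    refine div_nonneg (sub_nonneg.2 ?_) zero_le_two
    exact intervalIntegral.integral_mono_on (by linarith [Real.pi_pos])
      (supportFn_intervalIntegrable hKne (hΩb.subset hKΩ) _ _)
      (supportFn_intervalIntegrable hΩne hΩb _ _)
      fun θ _ => supportFn_le hKne fun z hz => normalCoord_le_supportFn hΩb θ (hKΩ hz)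
  rw [lineMeasure_avoiding_inter_hitBand hKne hKΩ hΩb] at hlim
  have hlim' := (ENNReal.tendsto_toReal ENNReal.ofReal_ne_top).comp hlim
  rw [ENNReal.toReal_ofReal hnum] at hlim'
  have hden : lineMeasure {G | (G.points ∩ Ω).Nonempty}
      = ENNReal.ofReal (∫ θ in (-Real.pi)..Real.pi, supportFn Ω θ) := by
    rw [measure_congr (hit_ae_eq_hitBand hΩne hΩb hΩ), lineMeasure_hitBand hΩne hΩb]
  have hlim'' := hlim'.div_const (∫ θ in (-Real.pi)..Real.pi, supportFn Ω θ)
  unfold Network.WeakestConnProb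
  rw [perimeter_eq_integral hΩne hΩb, perimeter_eq_integral hKne (hΩb.subset hKΩ)]
  convert hlim'' using 2
  · rw [Network.connProb, geomProb, ENNReal.toReal_div, hcongr, hden,
      ENNReal.toReal_ofReal (integral_supportFn_nonneg hΩne hΩb)]
    rfl
  · rw [div_div]
    congr 1
    ring

lemma InnerPartsSeparated.swap {O₁ O₂ : Path s t} (h : InnerPartsSeparated O₁ O₂) :
    InnerPartsSeparated O₂ O₁ := fun x hx y hy => by
  rw [mul_comm]
  exact h y hy x hx

end Weakest

end DisasterNetwork

end

/-! ### The corollary, by symmetry in the two outer routes -/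

theorem corollary1 {ι : Type*} [Finite ι] (N : DisasterNetwork.Network ι) (Ω : Set ℂ)
    (hΩ_convex : Convex ℝ Ω) (hΩ_bounded : Bornology.IsBounded Ω) (hN : ∀ e, N.trace e ⊆ Ω)
    (s t : ℂ) (O₁ O₂ : Path s t) (hO : N.IsOuterPair O₁ O₂)
    (hsep : DisasterNetwork.InnerPartsSeparated O₁ O₂)
    (hI : DisasterNetwork.IsInnerPlusSegments O₁ O₂ ∨ DisasterNetwork.IsInnerPlusSegments O₂ O₁)
    (r : ℝ) (hr₀ : 0 < r) (hr₁ : r < 1) :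
    N.WeakestConnProb Ω s t r
      ((DisasterNetwork.perimeter Ω + DisasterNetwork.perimeter (segment ℝ s t)
          - (DisasterNetwork.perimeter (convexHull ℝ (DisasterNetwork.inner O₁ O₂ ∪ segment ℝ s t))
            + DisasterNetwork.perimeter
                (convexHull ℝ (DisasterNetwork.inner O₂ O₁ ∪ segment ℝ s t))))
        / (2 * DisasterNetwork.perimeter Ω)) := by
  rcases hI with hI | hI
  · exact DisasterNetwork.weakestConnProb_of_isInnerPlusSegments hΩ_convex hΩ_bounded hN hO hsep hI
      hr₀ hr₁
  · rw [add_comm (DisasterNetwork.perimeter (convexHull ℝ (DisasterNetwork.inner O₁ O₂ ∪ _)))]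
    exact DisasterNetwork.weakestConnProb_of_isInnerPlusSegments hΩ_convex hΩ_bounded hN hO.swap
      hsep.swap hI hr₀ hr₁
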